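/- Let $A$ be a totally ordered integral domain (commutative with $1$). \emph{Proximity $f$-algebras.} All rings have an identity. An \emph{$\ell$-ring} is a ring $S$ with a lattice order such that $s\le t$ implies $s+r\le t+r$, and $s,t\ge 0$ implies $st\ge 0$. It is an \emph{$f$-ring} if it is a subdirect product (as an $\ell$-ring) of totally ordered rings. An \emph{$f$-algebra} over $A$ is an $f$-ring $S$ that is an $A$-algebra with $as\ge 0$ whenever $0\le a\in A$ and $0\le s\in S$; it is \emph{torsion-free} if $as=0$ implies $a=0$ or $s=0$. The zero algebra is allowed. A \emph{proximity} on a torsion-free $f$-algebra $S$ over $A$ is a binary relation $\prec$ on $S$ such that, for all $s,t,r,u\in S$: (P1) $0\prec 0$ and $1\prec 1$; (P2) $s\prec t$ implies $s\le t$; (P3) $s\le t\prec r\le u$ implies $s\prec u$; (P4) $s\prec t$ and $s\prec r$ imply $s\prec t\wedge r$; (P5) $s\prec t$ implies $-t\prec -s$; (P6) $s\prec t$ and $r\prec u$ imply $s+r\prec t+u$; (P7) $s\prec t$ implies $as\prec at$ for each $0<a\in A$, and $as\prec at$ for some $0<a\in A$ implies $s\prec t$; (P8) if $s,t,r,u\ge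 0$, $s\prec t$ and $r\prec u$, then $sr\prec tu$; (P9) $s\prec t$ implies that there is $r\in S$ with $s\prec r\prec t$; (P10) $s>0$ implies that there is $t\in S$ with $0<t\prec s$. A \emph{proximity $f$-algebra} over $A$ is a pair $(S,\prec)$ of a torsion-free $f$-algebra $S$ over $A$ and a proximity $\prec$ on $S$. \emph{Proximity Baer Specker algebras.} A commutative $A$-algebra $S$ is a \emph{Specker $A$-algebra} if it is generated as an $A$-algebra by a Boolean subalgebra $B$ of its Boolean algebra of idempotents (with $e\wedge f=ef$ and $\neg e=1-e$) such that for each $0\ne e\in B$ and $a\in A$, $ae=0$ implies $a=0$. A \emph{Baer ring} is a commutative ring in which the annihilator of each subset is the ideal generated by some idempotent. A \emph{proximity Baer Specker $A$-algebra} is a proximity $f$-algebra $(S,\prec)$ over $A$ such that $S$ is a Specker $A$-algebra and a Baer ring. \emph{De Vries powers.} Let $X$ be a (possibly empty) compact Hausdorff space. For $a\in A$ put ${\uparrow}a=\{b\in A: a\le b\}$. Let $FN(X)$ be the set of functions $f:X\to A$ with finitely many values such that $f^{-1}({\uparrow}a)$ is regular open for each $a\in A$. For an arbitrary $f:X\to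 A$ with finitely many values, its normalization $f^\#$ is the unique element of $FN(X)$ with $(f^\#)^{-1}({\uparrow}a)=\mathrm{Int}(\mathrm{Cl}(f^{-1}({\uparrow}a)))$ for all $a\in A$. The set $FN(X)$, ordered pointwise, is an $\ell$-algebra over $A$ in which sums, products, negatives, scalar multiples and joins are the normalizations of the corresponding pointwise operations, meets are pointwise, and $0,1$ are the constant functions. The \emph{de Vries power} of $A$ by $X$ is $(FN(X),\prec_X)$, where $f\prec_X g$ iff $\mathrm{Cl}(f^{-1}({\uparrow}a))\subseteq g^{-1}({\uparrow}a)$ for each $a\in A$. \textbf{Corollary.} Let $(S,\prec)$ be a proximity $f$-algebra over $A$. Then the following are equivalent: (i) there are a compact Hausdorff space $X$ and an isomorphism $\eta:S\to FN(X)$ of $A$-algebras and of lattices such that, for all $s,t\in S$, $s\prec t$ if and only if $\eta(s)\prec_X\eta(t)$; (ii) $(S,\prec)$ is a proximity Baer Specker $A$-algebra. -/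

import Mathlib

universe u v

/-! ## Lattice-ordered rings and algebras, proximities -/

/-- A lattice-ordered ring. -/
structure IsLatticeOrderedRing (S : Type*) [Ring S] [Lattice S] : Prop where
  add_le_add_right : ∀ s t : S, s ≤ t → ∀ r : S, s + r ≤ t + r
  mul_nonneg : ∀ s t : S, 0 ≤ s → 0 ≤ t → 0 ≤ s * t

/-- An `f`-ring: a lattice-ordered ring that is a subdirect product of totally ordered rings. -/
structure IsFRing (S : Type u) [Ring S] [Lattice S] : Prop extends IsLatticeOrderedRing S where
  subdirect : ∃ (ι : Type u) (T : ι → Type u) (_ : ∀ i, Ring (T i)) (_ : ∀ i, LinearOrder (T i))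
      (π : ∀ i, S →+* T i),
    (∀ i, IsLatticeOrderedRing (T i)) ∧
    (∀ i, Function.Surjective (π i)) ∧
    (∀ i s t, π i (s ⊔ t) = π i s ⊔ π i t) ∧
    (∀ i s t, π i (s ⊓ t) = π i s ⊓ π i t) ∧
    (∀ s t : S, (∀ i, π i s = π i t) → s = t)

/-- A proximity on an `A`-algebra `S` that carries a lattice order. -/
structure IsProximity (A : Type*) [CommRing A] [LinearOrder A] (S : Type*) [Ring S] [Algebra A S]
    [Lattice S] (prec : S → S → Prop) : Prop where
  zero_zero : prec 0 0
  one_one : prec 1 1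
  le : ∀ s t, prec s t → s ≤ t
  mono : ∀ s t r u, s ≤ t → prec t r → r ≤ u → prec s u
  inf : ∀ s t r, prec s t → prec s r → prec s (t ⊓ r)
  neg : ∀ s t, prec s t → prec (-t) (-s)
  add : ∀ s t r u, prec s t → prec r u → prec (s + r) (t + u)
  smul : ∀ s t, prec s t → ∀ a : A, 0 < a → prec (a • s) (a • t)
  of_smul : ∀ s t, (∃ a : A, 0 < a ∧ prec (a • s) (a • t)) → prec s t
  mul : ∀ s t r u, 0 ≤ s → 0 ≤ t → 0 ≤ r → 0 ≤ u → prec s t → prec r u → prec (s * r) (t * u)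
  interpolate : ∀ s t, prec s t → ∃ r, prec s r ∧ prec r t
  below : ∀ s, 0 < s → ∃ t, 0 < t ∧ prec t s

/-- A proximity `f`-algebra over `A` (also called a proximity `A`-algebra): a torsion-free
`f`-algebra over `A` with a proximity. -/
structure IsProximityFAlgebra (A : Type*) [CommRing A] [LinearOrder A] (S : Type*) [Ring S]
    [Algebra A S] [Lattice S] (prec : S → S → Prop) : Prop where
  isFRing : IsFRing S
  smul_nonneg : ∀ (a : A) (s : S), 0 ≤ a → 0 ≤ s → 0 ≤ a • s
  torsionFree : ∀ (a : A) (s : S), a • s = 0 → a = 0 ∨ s = 0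
  isProximity : IsProximity A S prec

/-! ## Specker algebras and Baer rings -/

/-- A Specker `A`-algebra: a commutative `A`-algebra generated by a Boolean algebra `B` of
idempotents (with `e ∧ f = e * f` and `¬ e = 1 - e`) whose nonzero elements are faithful. -/
structure IsSpecker (A : Type*) [CommRing A] (S : Type*) [Ring S] [Algebra A S] : Prop where
  mul_comm : ∀ s t : S, s * t = t * s
  generated : ∃ B : Set S,
    (∀ e ∈ B, IsIdempotentElem e) ∧
    (1 : S) ∈ B ∧
    (∀ e ∈ B, ∀ f ∈ B, e * f ∈ B) ∧
    (∀ e ∈ B, 1 - e ∈ B) ∧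
    (∀ e ∈ B, e ≠ 0 → ∀ a : A, a • e = 0 → a = 0) ∧
    Algebra.adjoin A B = ⊤

/-- A Baer ring: a commutative ring in which the annihilator of each subset is the ideal generated
by an idempotent. -/
structure IsBaerRing (S : Type*) [Ring S] : Prop where
  mul_comm : ∀ s t : S, s * t = t * s
  annihilator : ∀ T : Set S, ∃ e : S, IsIdempotentElem e ∧
    {s : S | ∀ t ∈ T, s * t = 0} = (Ideal.span {e} : Set S)

/-- A proximity Baer Specker `A`-algebra. -/
structure IsProximityBaerSpecker (A : Type*) [CommRing A] [LinearOrder A] (S : Type*) [Ring S]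
    [Algebra A S] [Lattice S] (prec : S → S → Prop) : Prop
    extends IsProximityFAlgebra A S prec where
  isSpecker : IsSpecker A S
  isBaer : IsBaerRing S

/-! ## Finitely valued normal functions -/

/-- `FN X A`: the functions `f : X → A` with finitely many values such that `f ⁻¹' {b | a ≤ b}` is
regular open for each `a`. -/
@[ext] structure FN (X A : Type*) [TopologicalSpace X] [LinearOrder A] where
  toFun : X → A
  finite : (Set.range toFun).Finite
  normal : ∀ a, interior (closure (toFun ⁻¹' Set.Ici a)) = toFun ⁻¹' Set.Ici a

namespace FN

section Normalization

variable {X A : Type*} [TopologicalSpace X] [LinearOrder A]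

instance : CoeFun (FN X A) (fun _ => X → A) := ⟨FN.toFun⟩

theorem coe_injective {f g : FN X A} (h : ∀ x, f x = g x) : f = g :=
  FN.ext (funext h)

open Classical in
/-- The values `a` of `f` such that `x` lies in the interior of the closure of
`f ⁻¹' {b | a ≤ b}`. -/
noncomputable def valuesAt (f : X → A) (hf : (Set.range f).Finite) (x : X) : Finset A :=
  hf.toFinset.filter (fun a => x ∈ interior (closure (f ⁻¹' Set.Ici a)))

theorem mem_valuesAt {f : X → A} {hf : (Set.range f).Finite} {x : X} {a : A} :
    a ∈ valuesAt f hf x ↔ a ∈ Set.range f ∧ x ∈ interior (closure (f ⁻¹' Set.Ici a)) := by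
  simp only [valuesAt, Finset.mem_filter, Set.Finite.mem_toFinset]

theorem valuesAt_nonempty (f : X → A) (hf : (Set.range f).Finite) (x : X) :
    (valuesAt f hf x).Nonempty := by
  obtain ⟨a, ha, hmin⟩ := hf.toFinset.exists_min_image id ⟨f x, by simp⟩
  refine ⟨a, ?_⟩
  have h : f ⁻¹' Set.Ici a = Set.univ := by
    ext y
    simpa using hmin (f y) (by simp)
  exact mem_valuesAt.2 ⟨hf.mem_toFinset.1 ha, by simp [h]⟩

/-- The underlying function of the normalization of `f`: if `a₀ < ⋯ < aₙ` are the values of `f`,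
and `Uᵢ` is the interior of the closure of `f ⁻¹' {b | aᵢ ≤ b}`, it takes the value `aᵢ` on
`Uᵢ \ Uᵢ₊₁` (with `Uₙ₊₁ = ∅`). -/
noncomputable def normalizeFun (f : X → A) (hf : (Set.range f).Finite) (x : X) : A :=
  (valuesAt f hf x).max' (valuesAt_nonempty f hf x)

theorem normalizeFun_mem (f : X → A) (hf : (Set.range f).Finite) (x : X) :
    normalizeFun f hf x ∈ Set.range f ∧
      x ∈ interior (closure (f ⁻¹' Set.Ici (normalizeFun f hf x))) := by
  exact mem_valuesAt.1 ((valuesAt f hf x).max'_mem (valuesAt_nonempty f hf x))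

theorem le_normalizeFun_iff (f : X → A) (hf : (Set.range f).Finite) (x : X) (a : A) :
    a ≤ normalizeFun f hf x ↔ x ∈ interior (closure (f ⁻¹' Set.Ici a)) := by
  constructor
  · intro h
    exact interior_mono (closure_mono (Set.preimage_mono (Set.Ici_subset_Ici.2 h)))
      (normalizeFun_mem f hf x).2
  · intro h
    have hne : (f ⁻¹' Set.Ici a).Nonempty := closure_nonempty_iff.1 ⟨x, interior_subset h⟩
    obtain ⟨y, hy⟩ := hne
    obtain ⟨b, hb, hmin⟩ := (hf.toFinset.filter (fun b => a ≤ b)).exists_min_image id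
      ⟨f y, by simpa using hy⟩
    simp only [Finset.mem_filter, Set.Finite.mem_toFinset, id] at hb hmin
    have hEq : f ⁻¹' Set.Ici a = f ⁻¹' Set.Ici b := by
      ext z
      exact ⟨fun hz => hmin (f z) ⟨⟨z, rfl⟩, hz⟩, fun hz => hb.2.trans hz⟩
    refine hb.2.trans (Finset.le_max' _ _ ?_)
    exact mem_valuesAt.2 ⟨hb.1, hEq ▸ h⟩

theorem normalizeFun_preimage (f : X → A) (hf : (Set.range f).Finite) (a : A) :
    normalizeFun f hf ⁻¹' Set.Ici a = interior (closure (f ⁻¹' Set.Ici a)) := by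
  ext x
  exact le_normalizeFun_iff f hf x a

/-- The normalization of a finitely valued function. -/
noncomputable def normalize (f : X → A) (hf : (Set.range f).Finite) : FN X A where
  toFun := normalizeFun f hf
  finite := hf.subset (by
    rintro _ ⟨x, rfl⟩
    exact (normalizeFun_mem f hf x).1)
  normal a := by
    rw [normalizeFun_preimage, interior_closure_idem]

theorem isOpen_preimage (f : FN X A) (a : A) : IsOpen (f ⁻¹' Set.Ici a) := by
  rw [← f.normal a]
  exact isOpen_interior

theorem le_normalize_iff (f : X → A) (hf : (Set.range f).Finite) (x : X) (a : A) :
    a ≤ normalize f hf x ↔ x ∈ interior (closure (f ⁻¹' Set.Ici a)) :=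
  le_normalizeFun_iff f hf x a

theorem le_apply_iff (f : FN X A) (x : X) (a : A) :
    a ≤ f x ↔ x ∈ interior (closure (f ⁻¹' Set.Ici a)) := by
  rw [f.normal a]
  rfl

/-- The filter of sets with dense interior. -/
def denseFilter (X : Type*) [TopologicalSpace X] : Filter X where
  sets := {s | Dense (interior s)}
  univ_sets := by simp
  sets_of_superset := fun h hst => h.mono (interior_mono hst)
  inter_sets := fun {s t} hs ht => by
    rw [Set.mem_ofPred_eq] at hs ht ⊢
    rw [interior_inter]
    exact hs.inter_of_isOpen_left ht isOpen_interior

theorem mem_denseFilter {s : Set X} : s ∈ denseFilter X ↔ Dense (interior s) := Iff.rfl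

/-- `f` is locally constant on a dense open set. -/
def Tame {A : Type*} (f : X → A) : Prop := ∀ᶠ x in denseFilter X, ∀ᶠ y in nhds x, f y = f x

theorem Tame.map {A B : Type*} {f : X → A} (hf : Tame f) (F : A → B) :
    Tame (fun x => F (f x)) := by
  filter_upwards [hf] with x hx
  filter_upwards [hx] with y hy
  rw [hy]

theorem Tame.map₂ {A B C : Type*} {f : X → A} {g : X → B} (hf : Tame f) (hg : Tame g)
    (F : A → B → C) : Tame (fun x => F (f x) (g x)) := by
  filter_upwards [hf, hg] with x hx hx'
  filter_upwards [hx, hx'] with y hy hy'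
  rw [hy, hy']

theorem tame (f : FN X A) : Tame (f : X → A) := by
  have key : ∀ b ∈ Set.range f, ∀ᶠ x in denseFilter X, ∀ᶠ y in nhds x, (b ≤ f y ↔ b ≤ f x) := by
    intro b _
    have ho := f.isOpen_preimage b
    have hD : (frontier (f ⁻¹' Set.Ici b))ᶜ ∈ denseFilter X := by
      rw [mem_denseFilter, (isClosed_frontier.isOpen_compl).interior_eq,
        ← interior_eq_empty_iff_dense_compl]
      rw [← frontier_compl]
      exact interior_frontier ho.isClosed_compl
    filter_upwards [hD] with x hx
    by_cases hxb : b ≤ f x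
    · filter_upwards [ho.mem_nhds hxb] with y hy
      exact ⟨fun _ => hxb, fun _ => hy⟩
    · have hxc : x ∉ closure (f ⁻¹' Set.Ici b) := fun hc =>
        hx ⟨hc, by rw [ho.interior_eq]; exact hxb⟩
      filter_upwards [isClosed_closure.isOpen_compl.mem_nhds hxc] with y hy
      exact ⟨fun h => absurd (subset_closure (show y ∈ f ⁻¹' Set.Ici b from h)) hy, fun h => absurd h hxb⟩
  have h2 := (Filter.eventually_all_finite f.finite).2 key
  filter_upwards [h2] with x hx
  have h3 := (Filter.eventually_all_finite f.finite).2 hx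
  filter_upwards [h3] with y hy
  exact le_antisymm ((hy _ ⟨y, rfl⟩).1 le_rfl) ((hy _ ⟨x, rfl⟩).2 le_rfl)

theorem normalize_eventuallyEq (f : X → A) (hf : (Set.range f).Finite) (h : Tame f) :
    ∀ᶠ x in denseFilter X, normalize f hf x = f x := by
  filter_upwards [h] with x hx
  refine eq_of_forall_le_iff fun a => ?_
  rw [le_normalize_iff]
  constructor
  · intro ha
    obtain ⟨y, hy, hya⟩ := mem_closure_iff_nhds.1 (interior_subset ha) _ hx
    have hy' : f y = f x := hy
    rw [← hy']
    exact hya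
  · intro ha
    refine mem_interior_iff_mem_nhds.2 (Filter.mem_of_superset hx fun y hy => subset_closure ?_)
    have hy' : f y = f x := hy
    exact ha.trans hy'.ge

theorem ext_of_eventuallyEq {f g : FN X A} (h : ∀ᶠ x in denseFilter X, f x = g x) : f = g := by
  have key : ∀ f g : FN X A, (∀ᶠ x in denseFilter X, f x = g x) → ∀ a,
      f ⁻¹' Set.Ici a ⊆ g ⁻¹' Set.Ici a := by
    intro f g h a
    rw [← g.normal a]
    refine interior_maximal ?_ (f.isOpen_preimage a)
    have hd : Dense (interior {x | f x = g x}) := h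
    refine (hd.open_subset_closure_inter (f.isOpen_preimage a)).trans (closure_mono ?_)
    rintro x ⟨hxa, hx⟩
    have hx' : x ∈ {x | f x = g x} := interior_subset hx
    rw [Set.mem_ofPred_eq] at hx'
    change a ≤ g x
    rw [← hx']
    exact hxa
  refine coe_injective fun x => eq_of_forall_le_iff fun a => ?_
  exact ⟨fun hx => key f g h a hx, fun hx => key g f (h.mono fun _ => Eq.symm) a hx⟩

/-- A constant function. -/
def const (X : Type*) [TopologicalSpace X] (a : A) : FN X A where
  toFun := fun _ => a
  finite := (Set.finite_singleton a).subset (by rintro _ ⟨x, rfl⟩; rfl)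
  normal b := by
    by_cases h : b ≤ a <;> simp [Set.preimage, h]

theorem finite_map (f : FN X A) (F : A → A) : (Set.range (fun x => F (f x))).Finite :=
  (f.finite.image F).subset (by rintro _ ⟨x, rfl⟩; exact ⟨_, ⟨x, rfl⟩, rfl⟩)

theorem finite_map₂ (f g : FN X A) (F : A → A → A) :
    (Set.range (fun x => F (f x) (g x))).Finite :=
  (f.finite.image2 F g.finite).subset
    (by rintro _ ⟨x, rfl⟩; exact ⟨_, ⟨x, rfl⟩, _, ⟨x, rfl⟩, rfl⟩)

/-- The lift of a unary operation on `A`: the normalization of the pointwise operation. -/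
noncomputable def map (F : A → A) (f : FN X A) : FN X A :=
  normalize (fun x => F (f x)) (f.finite_map F)

/-- The lift of a binary operation on `A`: the normalization of the pointwise operation. -/
noncomputable def map₂ (F : A → A → A) (f g : FN X A) : FN X A :=
  normalize (fun x => F (f x) (g x)) (f.finite_map₂ g F)

theorem map_eventuallyEq (F : A → A) (f : FN X A) :
    ∀ᶠ x in denseFilter X, map F f x = F (f x) :=
  normalize_eventuallyEq _ _ (f.tame.map F)

theorem map₂_eventuallyEq (F : A → A → A) (f g : FN X A) :
    ∀ᶠ x in denseFilter X, map₂ F f g x = F (f x) (g x) :=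
  normalize_eventuallyEq _ _ (f.tame.map₂ g.tame F)

/-- The pointwise order. -/
instance : PartialOrder (FN X A) where
  le f g := ∀ x, f x ≤ g x
  le_refl _ _ := le_rfl
  le_trans _ _ _ h h' x := (h x).trans (h' x)
  le_antisymm _ _ h h' := coe_injective fun x => le_antisymm (h x) (h' x)

/-- The meet is pointwise, and the join is the normalization of the pointwise join. -/
noncomputable instance : Lattice (FN X A) where
  inf f g :=
    { toFun := fun x => min (f x) (g x)
      finite := f.finite_map₂ g min
      normal := fun a => by
        have h : (fun x => min (f x) (g x)) ⁻¹' Set.Ici a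
            = f ⁻¹' Set.Ici a ∩ g ⁻¹' Set.Ici a := by
          ext x; simp
        rw [h]
        refine subset_antisymm ?_ ?_
        · conv_rhs => rw [← f.normal a, ← g.normal a, ← interior_inter]
          exact interior_mono closure_inter_subset
        · exact interior_maximal subset_closure
            ((f.isOpen_preimage a).inter (g.isOpen_preimage a)) }
  inf_le_left _ _ _ := min_le_left _ _
  inf_le_right _ _ _ := min_le_right _ _
  le_inf _ _ _ h h' x := le_min (h x) (h' x)
  sup := map₂ max
  le_sup_left f g x := by
    refine (le_normalize_iff _ _ x _).2 ?_
    refine interior_mono (closure_mono ?_) ((f.le_apply_iff x _).1 le_rfl)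
    intro y hy
    exact le_max_of_le_left hy
  le_sup_right f g x := by
    refine (le_normalize_iff _ _ x _).2 ?_
    refine interior_mono (closure_mono ?_) ((g.le_apply_iff x _).1 le_rfl)
    intro y hy
    exact le_max_of_le_right hy
  sup_le f g k hf hg x := by
    refine (k.le_apply_iff x _).2 ?_
    refine interior_mono (closure_mono ?_) 
      ((le_normalize_iff (fun x => max (f x) (g x)) (f.finite_map₂ g max) x _).1 le_rfl)
    intro y hy
    exact le_trans (Set.mem_Ici.1 hy) (max_le (hf y) (hg y))

/-- The proximity of the de Vries power: `f ≺ g` iff the closure of `f ⁻¹' {b | a ≤ b}` is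
contained in `g ⁻¹' {b | a ≤ b}` for each `a`. -/
def Prec (f g : FN X A) : Prop :=
  ∀ a, closure (f ⁻¹' Set.Ici a) ⊆ g ⁻¹' Set.Ici a

end Normalization

section Algebra

variable {X A : Type*} [TopologicalSpace X] [CommRing A] [LinearOrder A]

noncomputable instance : Zero (FN X A) := ⟨const X 0⟩
noncomputable instance : One (FN X A) := ⟨const X 1⟩
noncomputable instance : Add (FN X A) := ⟨map₂ (· + ·)⟩
noncomputable instance : Mul (FN X A) := ⟨map₂ (· * ·)⟩
noncomputable instance : Neg (FN X A) := ⟨map (- ·)⟩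
noncomputable instance : SMul A (FN X A) := ⟨fun a => map (a * ·)⟩

theorem zero_apply (x : X) : (0 : FN X A) x = 0 := rfl
theorem one_apply (x : X) : (1 : FN X A) x = 1 := rfl

theorem add_ae (f g : FN X A) : ∀ᶠ x in denseFilter X, (f + g) x = f x + g x :=
  map₂_eventuallyEq _ f g
theorem mul_ae (f g : FN X A) : ∀ᶠ x in denseFilter X, (f * g) x = f x * g x :=
  map₂_eventuallyEq _ f g
theorem neg_ae (f : FN X A) : ∀ᶠ x in denseFilter X, (-f) x = -f x :=
  map_eventuallyEq _ f
theorem smul_ae (a : A) (f : FN X A) : ∀ᶠ x in denseFilter X, (a • f) x = a * f x :=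
  map_eventuallyEq _ f

/-- The ring operations are the normalizations of the pointwise operations. -/
noncomputable instance : CommRing (FN X A) where
  add_assoc f g h := ext_of_eventuallyEq (by
    filter_upwards [add_ae (f + g) h, add_ae f g, add_ae f (g + h), add_ae g h] with x h1 h2 h3 h4
    rw [h1, h2, h3, h4, add_assoc])
  zero_add f := ext_of_eventuallyEq (by
    filter_upwards [add_ae 0 f] with x h1
    rw [h1, zero_apply, zero_add])
  add_zero f := ext_of_eventuallyEq (by
    filter_upwards [add_ae f 0] with x h1
    rw [h1, zero_apply, add_zero])
  add_comm f g := ext_of_eventuallyEq (by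
    filter_upwards [add_ae f g, add_ae g f] with x h1 h2
    rw [h1, h2, add_comm])
  neg_add_cancel f := ext_of_eventuallyEq (by
    filter_upwards [add_ae (-f) f, neg_ae f] with x h1 h2
    rw [h1, h2, zero_apply, neg_add_cancel])
  nsmul := nsmulRec
  zsmul := zsmulRec
  mul_assoc f g h := ext_of_eventuallyEq (by
    filter_upwards [mul_ae (f * g) h, mul_ae f g, mul_ae f (g * h), mul_ae g h] with x h1 h2 h3 h4
    rw [h1, h2, h3, h4, mul_assoc])
  one_mul f := ext_of_eventuallyEq (by
    filter_upwards [mul_ae 1 f] with x h1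
    rw [h1, one_apply, one_mul])
  mul_one f := ext_of_eventuallyEq (by
    filter_upwards [mul_ae f 1] with x h1
    rw [h1, one_apply, mul_one])
  mul_comm f g := ext_of_eventuallyEq (by
    filter_upwards [mul_ae f g, mul_ae g f] with x h1 h2
    rw [h1, h2, mul_comm])
  left_distrib f g h := ext_of_eventuallyEq (by
    filter_upwards [mul_ae f (g + h), add_ae g h, add_ae (f * g) (f * h), mul_ae f g, mul_ae f h]
      with x h1 h2 h3 h4 h5
    rw [h1, h2, h3, h4, h5, mul_add])
  right_distrib f g h := ext_of_eventuallyEq (by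
    filter_upwards [mul_ae (f + g) h, add_ae f g, add_ae (f * h) (g * h), mul_ae f h, mul_ae g h]
      with x h1 h2 h3 h4 h5
    rw [h1, h2, h3, h4, h5, add_mul])
  zero_mul f := ext_of_eventuallyEq (by
    filter_upwards [mul_ae 0 f] with x h1
    rw [h1, zero_apply, zero_mul])
  mul_zero f := ext_of_eventuallyEq (by
    filter_upwards [mul_ae f 0] with x h1
    rw [h1, zero_apply, mul_zero])

/-- Scalar multiplication is the normalization of the pointwise one; `a : A` is sent to the
constant function `a`. -/
noncomputable instance : Algebra A (FN X A) where
  algebraMap :=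
    { toFun := const X
      map_one' := rfl
      map_zero' := rfl
      map_mul' := fun a b => ext_of_eventuallyEq (by
        filter_upwards [mul_ae (const X a) (const X b)] with x h1
        rw [h1]; rfl)
      map_add' := fun a b => ext_of_eventuallyEq (by
        filter_upwards [add_ae (const X a) (const X b)] with x h1
        rw [h1]; rfl) }
  commutes' _ _ := mul_comm _ _
  smul_def' a f := ext_of_eventuallyEq (by
    filter_upwards [smul_ae a f, mul_ae (const X a) f] with x h1 h2
    exact h1.trans h2.symm)

end Algebra

end FN

/-! A finitely valued normal function is locally constant on a dense open set and is determined by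
its values there, so identities and inequalities in `FN X A` may be checked pointwise on a dense
open set.

From a de Vries power to (ii): every normal function is a finite combination of normalized
characteristic functions of its level sets (`FN.eq_sum_char`), so idempotents generate. The
annihilator of a subset is generated by the characteristic function of the complement of the closure
of the union of its supports (`FN.exists_annihilator_idempotent`).

Conversely, the Specker condition makes each element scalar on the blocks of a finite partition of
unity into idempotents (`IsSpecker.exists_stepPartition`). The proximity restricts to a de Vries
proximity on idempotents, whose round prime filters form a compact Hausdorff space. There `basic
prec e` is nonempty for `e ≠ 0`, and the closure of `basic prec e` lies in `basic prec f` exactly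
when `prec e f`. Reading an element off its blocks gives a function on a dense open set, and
normalizing gives `toFN`, an embedding of algebras and orders. The Baer condition is completeness of
the idempotents: every regular open set is some `basic prec e`, which gives surjectivity.

The proximities match by cutting into levels. If no value of `s` lies strictly between `b` and `a`,
then `(s ⊓ a) ⊔ b = b + (a - b) • e` with `e = [a ≤ s]`, so (P7) passes from elements to level
idempotents. Summing the layers `(a - b) • e` passes back. -/

namespace FN

/-! ### Normal functions form a Specker algebra and a Baer ring -/

section Generation

variable {X A : Type*} [TopologicalSpace X]

theorem eventually_denseFilter_of_isOpen {U : Set X} (hU : IsOpen U) (hd : Dense U) :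
    ∀ᶠ x in denseFilter X, x ∈ U := by
  change Dense (interior U)
  rwa [hU.interior_eq]

theorem exists_of_eventually {p : X → Prop} (h : ∀ᶠ x in denseFilter X, p x) {U : Set X}
    (hU : IsOpen U) (hne : U.Nonempty) : ∃ x ∈ U, p x := by
  have hd : Dense (interior {x | p x}) := h
  obtain ⟨x, hx, hp⟩ := hd.inter_open_nonempty U hU hne
  exact ⟨x, hx, interior_subset hp⟩

/-- A dense open set meets an open upper level set of `f` in a dense part of it, so that level set
lies in the closure of the one of `g`, which is regular open. -/
theorem le_of_eventually_le [LinearOrder A] {f g : FN X A}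
    (h : ∀ᶠ x in denseFilter X, f x ≤ g x) : f ≤ g := by
  intro x
  rw [g.le_apply_iff]
  have hx := (f.le_apply_iff x (f x)).1 le_rfl
  generalize f x = a at hx
  rw [f.normal a] at hx
  refine mem_interior.2 ⟨_, ?_, f.isOpen_preimage a, hx⟩
  have hd : Dense (interior {x | f x ≤ g x}) := h
  refine (hd.open_subset_closure_inter (f.isOpen_preimage a)).trans (closure_mono ?_)
  rintro y ⟨hya, hy⟩
  have hy' : y ∈ {x | f x ≤ g x} := interior_subset hy
  exact le_trans (Set.mem_Ici.1 hya) hy'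

theorem sup_ae [LinearOrder A] (f g : FN X A) : ∀ᶠ x in denseFilter X, (f ⊔ g) x = max (f x) (g x) :=
  map₂_eventuallyEq _ f g

theorem inf_apply [LinearOrder A] (f g : FN X A) (x : X) : (f ⊓ g) x = min (f x) (g x) := rfl

theorem const_apply [LinearOrder A] (a : A) (x : X) : const X a x = a := rfl

variable [CommRing A] [LinearOrder A]

theorem sub_ae (f g : FN X A) : ∀ᶠ x in denseFilter X, (f - g) x = f x - g x := by
  filter_upwards [add_ae f (-g), neg_ae g] with x h h'
  rw [sub_eq_add_neg, h, h', sub_eq_add_neg]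

theorem sum_ae {ι : Type*} (s : Finset ι) (f : ι → FN X A) :
    ∀ᶠ x in denseFilter X, (∑ i ∈ s, f i) x = ∑ i ∈ s, f i x := by
  classical
  induction s using Finset.induction_on with
  | empty => simp [zero_apply]
  | insert i s hi ih =>
    filter_upwards [ih, add_ae (f i) (∑ i ∈ s, f i)] with x h h'
    rw [Finset.sum_insert hi, Finset.sum_insert hi, h', h]

open Classical in
/-- The normalized characteristic function of a set. -/
noncomputable def char (A : Type*) [CommRing A] [LinearOrder A] (U : Set X) : FN X A :=
  normalize (fun x => if x ∈ U then (1 : A) else 0)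
    ((Set.toFinite {(1 : A), 0}).subset (by rintro _ ⟨x, rfl⟩; by_cases h : x ∈ U <;> simp [h]))

open Classical in
theorem char_ae_of_tame {U : Set X} (hU : Tame (· ∈ U)) :
    ∀ᶠ x in denseFilter X, char A U x = if x ∈ U then (1 : A) else 0 :=
  normalize_eventuallyEq _ _ (hU.map fun p => if p then (1 : A) else 0)

theorem tame_mem_of_isOpen {U : Set X} (hU : IsOpen U) : Tame (· ∈ U) := by
  have hD : (frontier U)ᶜ ∈ denseFilter X := by
    rw [mem_denseFilter, (isClosed_frontier.isOpen_compl).interior_eq,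
      ← interior_eq_empty_iff_dense_compl, ← frontier_compl]
    exact interior_frontier hU.isClosed_compl
  filter_upwards [hD] with x hx
  by_cases hxb : x ∈ U
  · filter_upwards [hU.mem_nhds hxb] with y hy
    exact propext ⟨fun _ => hxb, fun _ => hy⟩
  · have hxc : x ∉ closure U := fun hc => hx ⟨hc, by rw [hU.interior_eq]; exact hxb⟩
    filter_upwards [isClosed_closure.isOpen_compl.mem_nhds hxc] with y hy
    exact propext ⟨fun h => absurd (subset_closure h) hy, fun h => absurd h hxb⟩

open Classical in
theorem char_ae {U : Set X} (hU : IsOpen U) :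
    ∀ᶠ x in denseFilter X, char A U x = if x ∈ U then (1 : A) else 0 :=
  char_ae_of_tame (tame_mem_of_isOpen hU)

theorem isIdempotentElem_char {U : Set X} (hU : Tame (· ∈ U)) :
    IsIdempotentElem (char A U) := by
  refine ext_of_eventuallyEq ?_
  filter_upwards [char_ae_of_tame (A := A) hU, mul_ae (char A U) (char A U)] with x h h'
  rw [h', h]
  split_ifs <;> simp

/-- A level set `{x | f x = a}` need not be open, but membership in it is locally constant on a
dense open set. This is enough for its normalized characteristic function to be correct there. -/
theorem eq_sum_char (f : FN X A) :
    f = ∑ a ∈ f.finite.toFinset, a • char A {x | f x = a} := by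
  classical
  refine ext_of_eventuallyEq ?_
  have h := (Filter.eventually_all_finset f.finite.toFinset).2
    fun a _ => (char_ae_of_tame (A := A) (U := {x | f x = a}) (f.tame.map (fun b => b = a))).and
      (smul_ae a (char A {x | f x = a}))
  filter_upwards [h, sum_ae f.finite.toFinset fun a => a • char A {x | f x = a}] with x h h'
  have h2 : ∀ a ∈ f.finite.toFinset,
      (a • char A {x | f x = a}) x = if f x = a then a else 0 := fun a ha => by
    rw [(h a ha).2, (h a ha).1, mul_ite, mul_one, mul_zero]
    congr
  rw [h', Finset.sum_congr rfl h2, Finset.sum_ite_eq, if_pos (by simp)]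

theorem adjoin_idempotents :
    Algebra.adjoin A {e : FN X A | IsIdempotentElem e} = ⊤ := by
  refine eq_top_iff.2 fun f _ => ?_
  have hmem : ∀ a, char A {x | f x = a} ∈ Algebra.adjoin A {e : FN X A | IsIdempotentElem e} :=
    fun a => by
      have ht : Tame (· ∈ {x | f x = a}) := f.tame.map (fun b => b = a)
      have he := isIdempotentElem_char (A := A) ht
      exact Algebra.subset_adjoin he
  rw [eq_sum_char f]
  exact sum_mem fun a _ => Subalgebra.smul_mem _ (hmem a) a

theorem exists_annihilator_idempotent [NoZeroDivisors A] (T : Set (FN X A)) :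
    ∃ e : FN X A, IsIdempotentElem e ∧ ∀ s, (∀ t ∈ T, s * t = 0) ↔ s * e = s := by
  set U : Set X := ⋃ t ∈ T, interior {x | t x ≠ 0} with hU
  have hUo : IsOpen U := isOpen_biUnion fun _ _ => isOpen_interior
  have hc : IsOpen (closure U)ᶜ := isClosed_closure.isOpen_compl
  refine ⟨char A (closure U)ᶜ, isIdempotentElem_char (tame_mem_of_isOpen hc), fun s => ?_⟩
  constructor
  · intro hs
    refine ext_of_eventuallyEq ?_
    filter_upwards [char_ae (A := A) hc, mul_ae s (char A (closure U)ᶜ), s.tame,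
      tame_mem_of_isOpen hUo] with x h1 h2 h3 h4
    rw [h2, h1]
    by_cases hx : x ∈ closure U
    · obtain ⟨y, hy, hyU⟩ := mem_closure_iff_nhds.1 hx _ h4
      have hxU : x ∈ U := by rw [Set.mem_ofPred_eq] at hy; exact hy ▸ hyU
      obtain ⟨t, htT, hxt⟩ := Set.mem_iUnion₂.1 hxU
      -- The dense set on which `s * t` is the pointwise product depends on `t`, and `T` may be
      -- infinite. Hence `t` is evaluated at a point `z` near `x` where `s` still has the value `s
      -- x`.
      obtain ⟨V, hV, hVo, hxV⟩ := mem_nhds_iff.1 h3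
      obtain ⟨z, ⟨hzV, hzt⟩, hz⟩ := exists_of_eventually (mul_ae s t)
        (hVo.inter isOpen_interior) ⟨x, hxV, hxt⟩
      have hz0 : s z = s x := hV hzV
      have hz1 : t z ≠ 0 := (interior_subset hzt :)
      rw [hs t htT, zero_apply, hz0] at hz
      rw [(mul_eq_zero.1 hz.symm).resolve_right hz1, zero_mul]
    · simp [hx]
  · intro hs t ht
    refine ext_of_eventuallyEq ?_
    filter_upwards [char_ae (A := A) hc, mul_ae s (char A (closure U)ᶜ), mul_ae s t,
      t.tame] with x h1 h2 h3 h4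
    rw [h3, zero_apply]
    by_cases hx : t x = 0
    · rw [hx, mul_zero]
    · have hxU : x ∈ U := Set.mem_iUnion₂.2 ⟨t, ht, mem_interior_iff_mem_nhds.2 (by
        filter_upwards [h4] with y hy
        exact fun h0 => hx (hy.symm.trans h0))⟩
      rw [hs, h1] at h2
      have : s x = 0 := by simpa [subset_closure hxU] using h2
      rw [this, zero_mul]

end Generation

end FN

theorem isSpecker_of_algEquiv_FN {A S X : Type*} [CommRing A] [LinearOrder A] [Ring S]
    [Algebra A S] [TopologicalSpace X] (η : S ≃ₐ[A] FN X A)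
    (htf : ∀ (a : A) (s : S), a • s = 0 → a = 0 ∨ s = 0) : IsSpecker A S := by
  have hc : ∀ s t : S, s * t = t * s := fun s t => η.injective (by
    rw [map_mul, map_mul, mul_comm])
  refine ⟨hc, {e | IsIdempotentElem e}, fun e he => he, IsIdempotentElem.one,
    fun e he f hf => he.mul_of_commute (hc e f) hf, fun e he => he.one_sub,
    fun e _ h0 a h => (htf a e h).resolve_right h0, ?_⟩
  have h := congrArg (Subalgebra.map (η.symm : FN X A →ₐ[A] S))
    (FN.adjoin_idempotents (X := X) (A := A))
  rw [AlgHom.map_adjoin, Algebra.map_top, (AlgHom.range_eq_top _).2 η.symm.surjective] at h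
  rw [eq_top_iff, ← h]
  refine Algebra.adjoin_mono ?_
  rintro _ ⟨e, he, rfl⟩
  exact IsIdempotentElem.map he η.symm

theorem isBaerRing_of_algEquiv_FN {A S X : Type*} [CommRing A] [LinearOrder A] [NoZeroDivisors A]
    [Ring S] [Algebra A S] [TopologicalSpace X] (η : S ≃ₐ[A] FN X A) : IsBaerRing S := by
  refine ⟨fun s t => η.injective (by rw [map_mul, map_mul, mul_comm]), fun T => ?_⟩
  obtain ⟨e, he, h⟩ := FN.exists_annihilator_idempotent (η '' T)
  refine ⟨η.symm e, IsIdempotentElem.map he η.symm, ?_⟩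
  ext s
  have hs := h (η s)
  rw [Set.forall_mem_image] at hs
  rw [Set.mem_ofPred_eq, SetLike.mem_coe, Ideal.mem_span_singleton']
  have h1 : (∀ t ∈ T, s * t = 0) ↔ ∀ ⦃t⦄, t ∈ T → η s * η t = 0 := by
    simp_rw [← map_mul, map_eq_zero_iff η η.injective]
  rw [h1, hs]
  constructor
  · intro h2
    exact ⟨s, η.injective (by rw [map_mul, η.apply_symm_apply, h2])⟩
  · rintro ⟨r, rfl⟩
    rw [map_mul, η.apply_symm_apply, mul_assoc, he.eq]
-- Idempotents in f-rings
section FRing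

/-- Zero divisors are possible, so `e * (1 - e) = 0` does not decide. Instead `e` is compared with
`1 - e`: if `e ≤ 1 - e`, multiplying by `e ≥ 0` gives `e ≤ 0`. The other case is symmetric. -/
theorem IsIdempotentElem.eq_zero_or_one_of_linearOrder {T : Type*} [Ring T] [LinearOrder T]
    (h : IsLatticeOrderedRing T) {e : T} (he : IsIdempotentElem e) : e = 0 ∨ e = 1 := by
  have hadd := h.add_le_add_right
  have hsub : ∀ {s t : T}, s ≤ t → 0 ≤ t - s := fun {s t} hst => by
    simpa [sub_eq_add_neg] using hadd s t hst (-s)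
  have hle : ∀ {s t : T}, 0 ≤ t - s → s ≤ t := fun {s t} hst => by
    simpa using hadd 0 (t - s) hst s
  have hpos : ∀ {e : T}, IsIdempotentElem e → 0 ≤ e := by
    intro e he
    rcases le_total 0 e with h0 | h0
    · exact h0
    · have := h.mul_nonneg (0 - e) (0 - e) (hsub h0) (hsub h0)
      rwa [zero_sub, neg_mul_neg, he.eq] at this
  have key : ∀ {e : T}, IsIdempotentElem e → e ≤ 1 - e → e = 0 := by
    intro e he hl
    refine le_antisymm (hle ?_) (hpos he)
    have := h.mul_nonneg _ _ (hpos he) (hsub hl)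
    rwa [mul_sub, mul_sub, mul_one, he.eq, sub_self] at this
  rcases le_total e (1 - e) with hl | hl
  · exact Or.inl (key he hl)
  · refine Or.inr (sub_eq_zero.1 (key he.one_sub (by rwa [sub_sub_cancel]))).symm

theorem IsFRing.idempotent_nonneg {S : Type*} [Ring S] [Lattice S] (h : IsFRing S) {e : S}
    (he : IsIdempotentElem e) : 0 ≤ e := by
  obtain ⟨ι, T, _, _, π, hT, -, -, hinf, hext⟩ := h.subdirect
  refine inf_eq_left.1 (hext _ _ fun i => ?_)
  have h01 : (0 : T i) ≤ 1 := by
    rcases le_total (0 : T i) 1 with h0 | h0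
    · exact h0
    · have h1 : (0 : T i) ≤ -1 := by simpa using (hT i).add_le_add_right _ _ h0 (-1)
      simpa using (hT i).mul_nonneg _ _ h1 h1
  rw [hinf, map_zero]
  rcases IsIdempotentElem.eq_zero_or_one_of_linearOrder (hT i) (he.map (π i)) with h0 | h0 <;>
    simp [h0, h01]

/-- In each totally ordered factor `e` becomes `0` or `1`. This compatibility lets lattice
identities be checked block by block on a partition. -/
theorem IsFRing.sup_mul_idempotent {S : Type*} [Ring S] [Lattice S] (h : IsFRing S) {e : S}
    (he : IsIdempotentElem e) (x y : S) : (x ⊔ y) * e = x * e ⊔ y * e := by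
  obtain ⟨ι, T, _, _, π, hT, -, hsup, -, hext⟩ := h.subdirect
  refine hext _ _ fun i => ?_
  simp only [map_mul, hsup]
  rcases IsIdempotentElem.eq_zero_or_one_of_linearOrder (hT i) (he.map (π i)) with h0 | h0 <;>
    simp [h0]

theorem IsFRing.inf_mul_idempotent {S : Type*} [Ring S] [Lattice S] (h : IsFRing S) {e : S}
    (he : IsIdempotentElem e) (x y : S) : (x ⊓ y) * e = x * e ⊓ y * e := by
  obtain ⟨ι, T, _, _, π, hT, -, -, hinf, hext⟩ := h.subdirect
  refine hext _ _ fun i => ?_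
  simp only [map_mul, hinf]
  rcases IsIdempotentElem.eq_zero_or_one_of_linearOrder (hT i) (he.map (π i)) with h0 | h0 <;>
    simp [h0]

theorem IsFRing.isOrderedRing {S : Type*} [Ring S] [Lattice S] (h : IsFRing S) :
    IsOrderedRing S := by
  have hsub : ∀ {s t : S}, s ≤ t → 0 ≤ t - s := fun {s t} hst => by
    simpa [sub_eq_add_neg] using h.add_le_add_right s t hst (-s)
  have hle : ∀ {s t : S}, 0 ≤ t - s → s ≤ t := fun {s t} hst => by
    simpa using h.add_le_add_right 0 (t - s) hst s
  have : ZeroLEOneClass S := ⟨h.idempotent_nonneg IsIdempotentElem.one⟩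
  have : IsOrderedAddMonoid S := ⟨fun s t hst r => by
    exact h.add_le_add_right s t hst r, fun s t hst r => by
    simpa only [add_comm] using h.add_le_add_right s t hst r⟩
  have h1 : PosMulMono S := ⟨fun r hr s t hst => hle (by
    simpa [mul_sub] using h.mul_nonneg r (t - s) hr (hsub hst))⟩
  have h2 : MulPosMono S := ⟨fun r hr s t hst => hle (by
    simpa [sub_mul] using h.mul_nonneg (t - s) r (hsub hst) hr)⟩
  exact { mul_le_mul_of_nonneg_left := h1.mul_le_mul_of_nonneg_left
          mul_le_mul_of_nonneg_right := h2.mul_le_mul_of_nonneg_right }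

end FRing

/-! ### Step elements and finite partitions into idempotents -/

section Partition

/-- `s` is a step element: there is a finite partition of unity into orthogonal idempotents `e i`
on which `s` is the scalar `a i`. -/
structure StepPartition (A : Type*) {S : Type*} [CommRing A] [CommRing S] [Algebra A S] (s : S)
    (ι : Type) [Fintype ι] where
  idem : ι → S
  val : ι → A
  isIdempotentElem : ∀ i, IsIdempotentElem (idem i)
  orthogonal : ∀ i j, i ≠ j → idem i * idem j = 0
  sum_idem : ∑ i, idem i = 1
  mul_idem : ∀ i, s * idem i = val i • idem i

variable {A S : Type*} [CommRing A] [CommRing S] [Algebra A S]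

namespace StepPartition

variable {s t : S} {ι κ : Type} [Fintype ι] [Fintype κ]

theorem ext_mul (P : StepPartition A s ι) {x y : S} (h : ∀ i, x * P.idem i = y * P.idem i) :
    x = y := by
  rw [← mul_one x, ← mul_one y, ← P.sum_idem, Finset.mul_sum, Finset.mul_sum]
  exact Finset.sum_congr rfl fun i _ => h i

theorem le_of_mul_le [Lattice S] [IsOrderedRing S] (P : StepPartition A s ι) {x y : S}
    (h : ∀ i, x * P.idem i ≤ y * P.idem i) : x ≤ y := by
  rw [← mul_one x, ← mul_one y, ← P.sum_idem, Finset.mul_sum, Finset.mul_sum]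
  exact Finset.sum_le_sum fun i _ => h i

/-- The partition of a scalar. -/
def ofScalar (a : A) : StepPartition A (algebraMap A S a) Unit where
  idem _ := 1
  val _ := a
  isIdempotentElem _ := IsIdempotentElem.one
  orthogonal i j h := absurd (Subsingleton.elim i j) h
  sum_idem := by simp
  mul_idem _ := by rw [Algebra.smul_def]

/-- The partition of an idempotent. -/
def ofIdempotent {e : S} (he : IsIdempotentElem e) : StepPartition A e Bool where
  idem b := if b then e else 1 - e
  val b := if b then 1 else 0
  isIdempotentElem b := by cases b <;> simp [he, he.one_sub]
  orthogonal i j h := by cases i <;> cases j <;> simp_all [mul_sub, sub_mul, he.eq]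
  sum_idem := by simp
  mul_idem b := by cases b <;> simp [mul_sub, he.eq]

/-- The common refinement of two partitions. -/
def refine (P : StepPartition A s ι) (Q : StepPartition A t κ) (r : S) (F : A → A → A)
    (h : ∀ (e : S) (a b : A), s * e = a • e → t * e = b • e → r * e = F a b • e) :
    StepPartition A r (ι × κ) where
  idem p := P.idem p.1 * Q.idem p.2
  val p := F (P.val p.1) (Q.val p.2)
  isIdempotentElem p := (P.isIdempotentElem p.1).mul (Q.isIdempotentElem p.2)
  orthogonal p q hpq := by
    rw [mul_mul_mul_comm]
    by_cases h1 : p.1 = q.1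
    · rw [Q.orthogonal _ _ fun h2 => hpq (Prod.ext h1 h2), mul_zero]
    · rw [P.orthogonal _ _ h1, zero_mul]
  sum_idem := by
    rw [Fintype.sum_prod_type]
    simp_rw [← Finset.mul_sum, Q.sum_idem, mul_one, P.sum_idem]
  mul_idem p := by
    refine h _ _ _ ?_ ?_
    · rw [← mul_assoc, P.mul_idem, smul_mul_assoc]
    · rw [mul_left_comm, Q.mul_idem, mul_smul_comm]

/-- The partition of a sum. -/
def add (P : StepPartition A s ι) (Q : StepPartition A t κ) : StepPartition A (s + t) (ι × κ) :=
  P.refine Q (s + t) (· + ·) fun e a b h h' => by rw [add_mul, h, h', add_smul]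

/-- The partition of a product. -/
def mul (P : StepPartition A s ι) (Q : StepPartition A t κ) : StepPartition A (s * t) (ι × κ) :=
  P.refine Q (s * t) (· * ·) fun e a b h h' => by
    rw [mul_assoc, h', mul_smul_comm, h, smul_smul, mul_comm]

end StepPartition

/-- Scalars and idempotents have partitions, and common refinements close the class under sums and
products. -/
theorem IsSpecker.exists_stepPartition (h : IsSpecker A S) (s : S) :
    ∃ (ι : Type) (_ : Fintype ι), Nonempty (StepPartition A s ι) := by
  obtain ⟨B, hB, -, -, -, -, htop⟩ := h.generated
  have hs : s ∈ Algebra.adjoin A B := htop ▸ Algebra.mem_top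
  induction hs using Algebra.adjoin_induction with
  | mem e he => exact ⟨Bool, inferInstance, ⟨.ofIdempotent (hB e he)⟩⟩
  | algebraMap a => exact ⟨Unit, inferInstance, ⟨.ofScalar a⟩⟩
  | add s t _ _ hs ht =>
    obtain ⟨ι, _, ⟨P⟩⟩ := hs
    obtain ⟨κ, _, ⟨Q⟩⟩ := ht
    exact ⟨ι × κ, inferInstance, ⟨P.add Q⟩⟩
  | mul s t _ _ hs ht =>
    obtain ⟨ι, _, ⟨P⟩⟩ := hs
    obtain ⟨κ, _, ⟨Q⟩⟩ := ht
    exact ⟨ι × κ, inferInstance, ⟨P.mul Q⟩⟩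

end Partition

/-! ## The idempotents of a proximity algebra -/

/-- A de Vries proximity on the idempotents of a commutative ring, where `e ≤ f` means
`e * f = e`. -/
structure IsDeVriesProximity (S : Type*) [CommRing S] (prec : S → S → Prop) : Prop where
  zero_zero : prec 0 0
  le : ∀ e f, IsIdempotentElem e → IsIdempotentElem f → prec e f → e * f = e
  mono_left : ∀ e f g, IsIdempotentElem e → IsIdempotentElem f → e * f = e → prec f g → prec e g
  mono_right : ∀ e f g, IsIdempotentElem f → IsIdempotentElem g → f * g = f → prec e f → prec e g
  mul : ∀ e f g h, IsIdempotentElem e → IsIdempotentElem f → IsIdempotentElem g →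
    IsIdempotentElem h → prec e f → prec g h → prec (e * g) (f * h)
  compl : ∀ e f, prec e f → prec (1 - f) (1 - e)
  interpolate : ∀ e f, IsIdempotentElem e → IsIdempotentElem f → prec e f →
    ∃ g, IsIdempotentElem g ∧ prec e g ∧ prec g f
  below : ∀ e, IsIdempotentElem e → e ≠ 0 → ∃ f, IsIdempotentElem f ∧ f ≠ 0 ∧ prec f e

section Proximity

variable {A S : Type*} [CommRing A] [LinearOrder A] [CommRing S]
  [Algebra A S] [Lattice S] {prec : S → S → Prop}

theorem IsProximity.inf_inf (h : IsProximity A S prec) {s t r u : S} (h1 : prec s t)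
    (h2 : prec r u) : prec (s ⊓ r) (t ⊓ u) :=
  h.inf _ _ _ (h.mono _ _ _ _ inf_le_left h1 le_rfl) (h.mono _ _ _ _ inf_le_right h2 le_rfl)

theorem IsProximity.sup_sup [IsOrderedRing S] (h : IsProximity A S prec) {s t r u : S}
    (h1 : prec s t) (h2 : prec r u) : prec (s ⊔ r) (t ⊔ u) := by
  have := h.neg _ _ (h.inf_inf (h.neg _ _ h1) (h.neg _ _ h2))
  rwa [neg_inf, neg_inf, neg_neg, neg_neg, neg_neg, neg_neg] at this

variable [IsStrictOrderedRing A]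

/-- Scaling `1 ≺ 1` by (P7) handles positive scalars, and negation handles negative ones. Truncating
at a scalar therefore preserves the proximity. -/
theorem IsProximity.algebraMap_self (h : IsProximity A S prec) (a : A) :
    prec (algebraMap A S a) (algebraMap A S a) := by
  have key : ∀ a : A, 0 < a → prec (algebraMap A S a) (algebraMap A S a) :=
    fun a ha => by
      have := h.smul 1 1 h.one_one a ha
      rwa [← Algebra.algebraMap_eq_smul_one] at this
  rcases lt_trichotomy a 0 with ha | rfl | ha
  · simpa using h.neg _ _ (key (-a) (neg_pos.2 ha))
  · simpa using h.zero_zero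
  · exact key a ha

/-- If `s` and `t` take no values strictly between `b` and `a`, then `e` and `f` are the
idempotents `[a ≤ s]` and `[a ≤ t]`. -/
theorem IsProximity.of_level [IsOrderedRing S] (h : IsProximity A S prec) {s t e f : S} {a b : A}
    (hab : b < a) (hst : prec s t)
    (hs : (s ⊓ algebraMap A S a) ⊔ algebraMap A S b = algebraMap A S b + (a - b) • e)
    (ht : (t ⊓ algebraMap A S a) ⊔ algebraMap A S b = algebraMap A S b + (a - b) • f) :
    prec e f := by
  refine h.of_smul _ _ ⟨a - b, sub_pos.2 hab, ?_⟩
  have h1 := h.sup_sup (h.inf_inf hst (h.algebraMap_self a)) (h.algebraMap_self b)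
  rw [hs, ht] at h1
  simpa using h.add _ _ _ _ h1 (h.algebraMap_self (-b))

/-- On a block `s` is a scalar, either at least `a` or at most `b`, so truncation to the interval
from `b` to `a` leaves exactly `a` or `b` there. -/
theorem StepPartition.level (hF : IsFRing S) (hsm : ∀ (a : A) (s : S), 0 ≤ a → 0 ≤ s → 0 ≤ a • s)
    {s e : S} {ι : Type} [Fintype ι] (P : StepPartition A s ι) {a b : A} (hab : b ≤ a)
    (h : ∀ i, (a ≤ P.val i ∧ e * P.idem i = P.idem i) ∨ (P.val i ≤ b ∧ e * P.idem i = 0)) :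
    (s ⊓ algebraMap A S a) ⊔ algebraMap A S b = algebraMap A S b + (a - b) • e := by
  have := hF.isOrderedRing
  have hm : ∀ i {c d : A}, c ≤ d → c • P.idem i ≤ d • P.idem i := fun i c d hcd => by
    rw [← sub_nonneg, ← sub_smul]
    exact hsm _ _ (sub_nonneg.2 hcd) (hF.idempotent_nonneg (P.isIdempotentElem i))
  refine P.ext_mul fun i => ?_
  rw [hF.sup_mul_idempotent (P.isIdempotentElem i), hF.inf_mul_idempotent (P.isIdempotentElem i),
    P.mul_idem, ← Algebra.smul_def, ← Algebra.smul_def, add_mul, ← Algebra.smul_def,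
    smul_mul_assoc]
  rcases h i with ⟨h1, h2⟩ | ⟨h1, h2⟩
  · rw [inf_eq_right.2 (hm i h1), sup_eq_left.2 (hm i hab), h2, ← add_smul, add_sub_cancel]
  · rw [inf_eq_left.2 (hm i (h1.trans hab)), sup_eq_right.2 (hm i h1), h2, smul_zero, add_zero]

theorem IsFRing.idempotent_le_iff (hF : IsFRing S) {e f : S} (he : IsIdempotentElem e)
    (hf : IsIdempotentElem f) : e ≤ f ↔ e * f = e := by
  have := hF.isOrderedRing
  constructor
  · intro h
    have h1 := mul_le_mul_of_nonneg_right h (hF.idempotent_nonneg hf.one_sub)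
    rw [mul_sub, mul_sub, hf.eq, mul_one, mul_one, sub_self] at h1
    have h2 := mul_nonneg (hF.idempotent_nonneg he) (hF.idempotent_nonneg hf.one_sub)
    rw [mul_sub, mul_one] at h2
    exact (sub_eq_zero.1 (le_antisymm h1 h2)).symm
  · intro h
    have h2 := mul_nonneg (hF.idempotent_nonneg hf) (hF.idempotent_nonneg he.one_sub)
    rwa [mul_sub, mul_one, mul_comm, h, sub_nonneg] at h2

/-- The level equation of an idempotent. -/
theorem IsFRing.idempotent_level (hF : IsFRing S)
    (hsm : ∀ (a : A) (s : S), 0 ≤ a → 0 ≤ s → 0 ≤ a • s) {e : S} (he : IsIdempotentElem e)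
    {a b : A} (hb : 0 ≤ b) (hab : b ≤ a) (ha : a ≤ 1) :
    (e ⊓ algebraMap A S a) ⊔ algebraMap A S b = algebraMap A S b + (a - b) • e := by
  refine (StepPartition.ofIdempotent he).level hF hsm hab fun i => ?_
  cases i
  · exact Or.inr (by simp [StepPartition.ofIdempotent, mul_sub, he.eq, hb])
  · exact Or.inl (by simp [StepPartition.ofIdempotent, he.eq, ha])

/-- The interpolant `s` given by (P9) need not be idempotent; it is replaced by `g = [1 ≤ s]`.
Cutting `e ≺ s` just below level `1` gives `e ≺ g`, and `g ≤ s ≺ f` gives `g ≺ f`. -/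
theorem IsProximityFAlgebra.exists_idempotent_between (h : IsProximityFAlgebra A S prec)
    (hS : IsSpecker A S) {e f : S} (he : IsIdempotentElem e) (hef : prec e f) :
    ∃ g, IsIdempotentElem g ∧ prec e g ∧ prec g f := by
  classical
  have hF := h.isFRing
  have := hF.isOrderedRing
  obtain ⟨s, hes, hsf⟩ := h.isProximity.interpolate e f hef
  obtain ⟨ι, _, ⟨P⟩⟩ := hS.exists_stepPartition s
  have hs0 : 0 ≤ s := (hF.idempotent_nonneg he).trans (h.isProximity.le _ _ hes)
  -- The lower cut level is the largest value of `s` below `1`. Inserting `0` ensures that it exists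
  -- and is nonnegative, as the level equation for `e` requires.
  set V : Finset A := insert 0 ((Finset.univ.image P.val).filter (· < 1)) with hV
  have hVn : V.Nonempty := Finset.insert_nonempty _ _
  have hV1 : V.max' hVn < 1 := by
    rw [Finset.max'_lt_iff]
    intro c hc
    rcases Finset.mem_insert.1 hc with rfl | hc
    · exact one_pos
    · exact (Finset.mem_filter.1 hc).2
  have hV0 : 0 ≤ V.max' hVn := Finset.le_max' _ _ (Finset.mem_insert_self _ _)
  set g : S := ∑ i with 1 ≤ P.val i, P.idem i with hg
  have hgi : ∀ i, g * P.idem i = if 1 ≤ P.val i then P.idem i else 0 := by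
    intro i
    rw [hg, Finset.sum_mul, Finset.sum_filter, Finset.sum_eq_single i]
    · rw [(P.isIdempotentElem i).eq]
    · intro j _ hj
      rw [P.orthogonal j i hj, ite_self]
    · simp
  have hgg : IsIdempotentElem g := P.ext_mul fun i => by
    rw [mul_assoc, hgi i]
    split_ifs with h1
    · rw [hgi i, if_pos h1]
    · rw [mul_zero]
  refine ⟨g, hgg, ?_, ?_⟩
  · refine h.isProximity.of_level hV1 hes (hF.idempotent_level h.smul_nonneg he hV0 hV1.le le_rfl)
      (P.level hF h.smul_nonneg hV1.le fun i => ?_)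
    by_cases h1 : 1 ≤ P.val i
    · exact Or.inl ⟨h1, by rw [hgi, if_pos h1]⟩
    · refine Or.inr ⟨Finset.le_max' _ _ ?_, by rw [hgi, if_neg h1]⟩
      simpa [hV] using Or.inr (not_le.1 h1)
  · refine h.isProximity.mono _ _ _ _ (P.le_of_mul_le fun i => ?_) hsf le_rfl
    have hi := hF.idempotent_nonneg (P.isIdempotentElem i)
    rw [hgi]
    split_ifs with h1
    · have := h.smul_nonneg _ _ (sub_nonneg.2 h1) hi
      rwa [sub_smul, one_smul, sub_nonneg, ← P.mul_idem] at this
    · exact mul_nonneg hs0 hi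

theorem IsProximityFAlgebra.nonneg_of_smul_nonneg (h : IsProximityFAlgebra A S prec) {e : S}
    (he : 0 ≤ e) (h0 : e ≠ 0) {a : A} (ha : 0 ≤ a • e) : 0 ≤ a := by
  have := h.isFRing.isOrderedRing
  by_contra! hlt
  have h1 := h.smul_nonneg _ _ (neg_nonneg.2 hlt.le) he
  rw [neg_smul, neg_nonneg] at h1
  exact (h.torsionFree _ _ (le_antisymm h1 ha)).elim hlt.ne h0

/-- Take `0 < t ≺ e` from (P10) and a block `p` on which `t` is a nonzero scalar `a`; then `0 < a ≤
1`. Since `a • p ≤ t ⊓ a ≺ e ⊓ a = a • e`, cancelling `a` by (P7) gives `p ≺ e`. -/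
theorem IsProximityFAlgebra.exists_idempotent_below (h : IsProximityFAlgebra A S prec)
    (hS : IsSpecker A S) {e : S} (he : IsIdempotentElem e) (he0 : e ≠ 0) :
    ∃ f, IsIdempotentElem f ∧ f ≠ 0 ∧ prec f e := by
  have hF := h.isFRing
  have := hF.isOrderedRing
  obtain ⟨t, ht0, hte⟩ := h.isProximity.below e ((hF.idempotent_nonneg he).lt_of_ne' he0)
  obtain ⟨ι, _, ⟨P⟩⟩ := hS.exists_stepPartition t
  obtain ⟨i, hi⟩ : ∃ i, t * P.idem i ≠ 0 := by
    by_contra! hc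
    exact ht0.ne' (P.ext_mul fun i => by rw [hc, zero_mul])
  have hPi := P.isIdempotentElem i
  have hi0 := hF.idempotent_nonneg hPi
  have hi1 : P.idem i ≤ 1 := sub_nonneg.1 (hF.idempotent_nonneg hPi.one_sub)
  have hne : P.idem i ≠ 0 := fun h0 => hi (by rw [h0, mul_zero])
  have he1 : e ≤ 1 := sub_nonneg.1 (hF.idempotent_nonneg he.one_sub)
  have hv0 : 0 ≤ P.val i := h.nonneg_of_smul_nonneg hi0 hne
    (P.mul_idem i ▸ mul_nonneg ht0.le hi0)
  have hv : 0 < P.val i := hv0.lt_of_ne' fun h0 => hi (by rw [P.mul_idem, h0, zero_smul])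
  have hv1 : P.val i ≤ 1 := by
    refine sub_nonneg.1 (h.nonneg_of_smul_nonneg hi0 hne ?_)
    rw [sub_smul, one_smul, ← P.mul_idem, sub_nonneg]
    simpa using mul_le_mul_of_nonneg_right ((h.isProximity.le _ _ hte).trans he1) hi0
  refine ⟨P.idem i, hPi, hne, h.isProximity.of_smul _ _ ⟨P.val i, hv, ?_⟩⟩
  have h1 := h.isProximity.inf_inf hte (h.isProximity.algebraMap_self (P.val i))
  have h2 := hF.idempotent_level h.smul_nonneg he le_rfl hv0 hv1
  have h3 : 0 ≤ e ⊓ algebraMap A S (P.val i) := le_inf (hF.idempotent_nonneg he) (by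
    rw [Algebra.algebraMap_eq_smul_one]; exact h.smul_nonneg _ _ hv0 zero_le_one)
  rw [map_zero, zero_add, sub_zero, sup_eq_left.2 h3] at h2
  refine h.isProximity.mono _ _ _ _ (le_inf ?_ ?_) h1 h2.le
  · rw [← P.mul_idem]
    simpa using mul_le_mul_of_nonneg_left hi1 ht0.le
  · rw [Algebra.algebraMap_eq_smul_one, ← sub_nonneg, ← smul_sub]
    exact h.smul_nonneg _ _ hv0 (sub_nonneg.2 hi1)

theorem IsProximityFAlgebra.isDeVriesProximity (h : IsProximityFAlgebra A S prec)
    (hS : IsSpecker A S) : IsDeVriesProximity S prec where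
  zero_zero := h.isProximity.zero_zero
  le e f he hf hef := (h.isFRing.idempotent_le_iff he hf).1 (h.isProximity.le _ _ hef)
  mono_left e f g he hf hef hfg :=
    h.isProximity.mono _ _ _ _ ((h.isFRing.idempotent_le_iff he hf).2 hef) hfg le_rfl
  mono_right e f g hf hg hfg hef :=
    h.isProximity.mono _ _ _ _ le_rfl hef ((h.isFRing.idempotent_le_iff hf hg).2 hfg)
  mul e f g k he hf hg hk hef hgk := by
    have hF := h.isFRing
    exact h.isProximity.mul _ _ _ _ (hF.idempotent_nonneg he) (hF.idempotent_nonneg hf)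
      (hF.idempotent_nonneg hg) (hF.idempotent_nonneg hk) hef hgk
  compl e f hef := by
    simpa [sub_eq_add_neg] using
      h.isProximity.add _ _ _ _ h.isProximity.one_one (h.isProximity.neg _ _ hef)
  interpolate e f he _ hef := h.exists_idempotent_between hS he hef
  below e he h0 := h.exists_idempotent_below hS he h0

end Proximity
/-! ## The de Vries dual -/

/-- The points of the de Vries dual: the round prime filters of idempotents. -/
structure DeVriesPoint (S : Type u) [CommRing S] (prec : S → S → Prop) where
  carrier : Set S
  idem : ∀ e ∈ carrier, IsIdempotentElem e
  zero_notMem : (0 : S) ∉ carrier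
  mul_mem : ∀ e ∈ carrier, ∀ f ∈ carrier, e * f ∈ carrier
  mem_of_mul_eq : ∀ e ∈ carrier, ∀ f, IsIdempotentElem f → e * f = e → f ∈ carrier
  round : ∀ e ∈ carrier, ∃ f ∈ carrier, prec f e
  prime : ∀ e f, IsIdempotentElem e → IsIdempotentElem f → prec e f →
    f ∈ carrier ∨ 1 - e ∈ carrier

namespace DeVriesPoint

variable {S : Type u} [CommRing S] {prec : S → S → Prop}

theorem ext_carrier {x y : DeVriesPoint S prec} (h : x.carrier = y.carrier) : x = y := by
  cases x; cases y; cases h; rfl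

/-- The basic open set of an idempotent. -/
def basic (prec : S → S → Prop) (e : S) : Set (DeVriesPoint S prec) := {x | e ∈ x.carrier}

theorem mem_basic {e : S} {x : DeVriesPoint S prec} : x ∈ basic prec e ↔ e ∈ x.carrier := Iff.rfl

instance : TopologicalSpace (DeVriesPoint S prec) :=
  TopologicalSpace.generateFrom {U | ∃ e, IsIdempotentElem e ∧ basic prec e = U}

theorem isOpen_basic {e : S} (he : IsIdempotentElem e) : IsOpen (basic prec e) :=
  TopologicalSpace.isOpen_generateFrom_of_mem ⟨e, he, rfl⟩

theorem basic_mul {e f : S} (he : IsIdempotentElem e) (hf : IsIdempotentElem f) :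
    basic prec (e * f) = basic prec e ∩ basic prec f := by
  ext x
  refine ⟨fun h => ⟨?_, ?_⟩, fun h => x.mul_mem _ h.1 _ h.2⟩
  · exact x.mem_of_mul_eq _ h e he (by rw [mul_right_comm, he.eq])
  · exact x.mem_of_mul_eq _ h f hf (by rw [mul_assoc, hf.eq])

theorem basic_zero : basic prec (0 : S) = ∅ :=
  Set.eq_empty_of_forall_notMem fun x => x.zero_notMem

theorem basic_mono {e f : S} (hf : IsIdempotentElem f) (h : e * f = e) :
    basic prec e ⊆ basic prec f := fun x hx => x.mem_of_mul_eq e hx f hf h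

theorem disjoint_basic_compl {e : S} (he : IsIdempotentElem e) :
    Disjoint (basic prec e) (basic prec (1 - e)) := by
  rw [Set.disjoint_iff_inter_eq_empty, ← basic_mul he he.one_sub, mul_sub, he.eq, mul_one,
    sub_self, basic_zero]

/-- If `f` lies in `x` but not in `y`, roundness gives `e ≺ f` in `x` and primality puts `1 - e` in
`y`. The basic sets of `e` and `1 - e` separate the points. -/
theorem t2Space : T2Space (DeVriesPoint S prec) := by
  have key : ∀ x y : DeVriesPoint S prec, ¬ x.carrier ⊆ y.carrier →
      ∃ u v, IsOpen u ∧ IsOpen v ∧ x ∈ u ∧ y ∈ v ∧ Disjoint u v := by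
    intro x y h
    obtain ⟨f, hfx, hfy⟩ := Set.not_subset.1 h
    obtain ⟨e, hex, hef⟩ := x.round f hfx
    have he := x.idem e hex
    exact ⟨_, _, isOpen_basic he, isOpen_basic he.one_sub, hex,
      (y.prime e f he (x.idem f hfx) hef).resolve_left hfy, disjoint_basic_compl he⟩
  refine ⟨fun x y hxy => ?_⟩
  by_cases h : x.carrier ⊆ y.carrier
  · obtain ⟨u, v, hu, hv, hy, hx, hd⟩ := key y x fun h' => hxy (ext_carrier (h.antisymm h'))
    exact ⟨v, u, hv, hu, hx, hy, hd.symm⟩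
  · exact key x y h

variable (D : IsDeVriesProximity S prec)
include D

/-- Nonemptiness is not among the axioms of a point; it follows from primality applied to `0 ≺ 0`.
-/
theorem one_mem (x : DeVriesPoint S prec) : (1 : S) ∈ x.carrier := by
  have := x.prime 0 0 IsIdempotentElem.zero IsIdempotentElem.zero D.zero_zero
  rw [sub_zero] at this
  exact this.resolve_left x.zero_notMem

theorem isTopologicalBasis_basic : TopologicalSpace.IsTopologicalBasis
    {U | ∃ e, IsIdempotentElem e ∧ basic prec e = U} where
  exists_subset_inter := by
    rintro _ ⟨e, he, rfl⟩ _ ⟨f, hf, rfl⟩ x hx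
    exact ⟨_, ⟨e * f, he.mul hf, rfl⟩, by rwa [basic_mul he hf], (basic_mul he hf).subset⟩
  sUnion_eq := Set.eq_univ_of_forall fun x =>
    ⟨_, ⟨1, IsIdempotentElem.one, rfl⟩, one_mem D x⟩
  eq_generateFrom := rfl

theorem exists_basic_subset {U : Set (DeVriesPoint S prec)} (hU : IsOpen U)
    {x : DeVriesPoint S prec} (hx : x ∈ U) :
    ∃ e, IsIdempotentElem e ∧ x ∈ basic prec e ∧ basic prec e ⊆ U := by
  obtain ⟨_, ⟨e, he, rfl⟩, hxe, hU'⟩ :=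
    (isTopologicalBasis_basic D).exists_subset_of_mem_open hx hU
  exact ⟨e, he, hxe, hU'⟩

/-- The round part of a filter of idempotents that is prime up to the proximity is a point. -/
theorem exists_point_of_filter (y : Set S) (hidem : ∀ e ∈ y, IsIdempotentElem e)
    (h0 : (0 : S) ∉ y) (hmul : ∀ e ∈ y, ∀ f ∈ y, e * f ∈ y)
    (hone : ∃ e, e ∈ y)
    (hup : ∀ e ∈ y, ∀ f, IsIdempotentElem f → e * f = e → f ∈ y)
    (hprime : ∀ e f, IsIdempotentElem e → IsIdempotentElem f → prec e f → f ∈ y ∨ 1 - e ∈ y) :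
    ∃ x : DeVriesPoint S prec, ∀ f, f ∈ x.carrier ↔ IsIdempotentElem f ∧ ∃ e ∈ y, prec e f := by
  have hone' : (1 : S) ∈ y := by
    obtain ⟨e, he⟩ := hone
    exact hup e he 1 IsIdempotentElem.one (mul_one e)
  refine ⟨⟨{f | IsIdempotentElem f ∧ ∃ e ∈ y, prec e f}, fun e he => he.1, ?_, ?_, ?_, ?_, ?_⟩,
    fun f => Iff.rfl⟩
  · rintro ⟨_, e, he, hp⟩
    have := D.le e 0 (hidem e he) IsIdempotentElem.zero hp
    rw [mul_zero] at this
    exact h0 (this ▸ he)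
  · rintro e ⟨he, e', hey, hp⟩ f ⟨hf, f', hfy, hq⟩
    exact ⟨he.mul hf, _, hmul _ hey _ hfy,
      D.mul _ _ _ _ (hidem _ hey) he (hidem _ hfy) hf hp hq⟩
  · rintro e ⟨he, e', hey, hp⟩ f hf hef
    exact ⟨hf, e', hey, D.mono_right _ _ _ he hf hef hp⟩
  · rintro e ⟨he, e', hey, hp⟩
    obtain ⟨g, hg, h1, h2⟩ := D.interpolate e' e (hidem _ hey) he hp
    exact ⟨g, ⟨hg, e', hey, h1⟩, h2⟩
  · intro e f he hf hef
    -- Two interpolations `e ≺ k ≺ g ≺ f` are needed: primality of `y` is spent on `k ≺ g`, and the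
    -- outer relations place `f` or `1 - e` in the round part.
    obtain ⟨g, hg, h1, h2⟩ := D.interpolate e f he hf hef
    obtain ⟨k, hk, h3, h4⟩ := D.interpolate e g he hg h1
    rcases hprime k g hk hg h4 with h | h
    · exact Or.inl ⟨hf, g, h, h2⟩
    · exact Or.inr ⟨he.one_sub, 1 - k, h, D.compl _ _ h3⟩

/-- An ultrafilter converges to the round part of the filter of idempotents whose basic sets it
contains. -/
theorem compactSpace : CompactSpace (DeVriesPoint S prec) := by
  refine ⟨isCompact_iff_ultrafilter_le_nhds.2 fun 𝒰 _ => ?_⟩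
  obtain ⟨x, hx⟩ := exists_point_of_filter D {e | IsIdempotentElem e ∧ basic prec e ∈ 𝒰}
    (fun e he => he.1)
    (fun h => 𝒰.empty_notMem (by simpa [basic_zero] using h.2))
    (fun e he f hf => ⟨he.1.mul hf.1, by
      rw [basic_mul he.1 hf.1]; exact Filter.inter_mem he.2 hf.2⟩)
    ⟨1, IsIdempotentElem.one, Filter.mem_of_superset Filter.univ_mem fun y _ => one_mem D y⟩
    (fun e he f hf hef => ⟨hf, Filter.mem_of_superset he.2 (basic_mono hf hef)⟩)
    (fun e f he hf hef => by
      by_cases h : basic prec f ∈ 𝒰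
      · exact Or.inl ⟨hf, h⟩
      · refine Or.inr ⟨he.one_sub, Filter.mem_of_superset
          (Ultrafilter.compl_mem_iff_notMem.2 h) fun y hy => ?_⟩
        exact (y.prime e f he hf hef).resolve_left hy)
  refine ⟨x, trivial, (isTopologicalBasis_basic D).nhds_hasBasis.ge_iff.2 ?_⟩
  rintro _ ⟨⟨f, hf, rfl⟩, hxf⟩
  obtain ⟨-, e, ⟨he, he𝒰⟩, hef⟩ := (hx f).1 hxf
  exact Filter.mem_of_superset he𝒰 (basic_mono hf (D.le e f he hf hef))

/-- Choose a nonzero `d ≺ e` and a maximal ideal containing `1 - d`. The idempotents outside it form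
an ultrafilter containing `d`, so its round part contains `e`. -/
theorem basic_nonempty {e : S} (he : IsIdempotentElem e) (h0 : e ≠ 0) :
    (basic prec e).Nonempty := by
  obtain ⟨d, hd, hd0, hde⟩ := D.below e he h0
  obtain ⟨M, hM, hdM⟩ := Ideal.exists_le_maximal (Ideal.span {1 - d}) (by
    rw [Ne, Ideal.span_singleton_eq_top]
    intro hu
    refine hd0 (hu.mul_left_eq_zero.1 ?_)
    rw [mul_sub, hd.eq, mul_one, sub_self])
  have hdM' : 1 - d ∈ M := hdM (Ideal.mem_span_singleton_self _)
  have hp := hM.isPrime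
  have hsub : ∀ {e : S}, 1 - e ∈ M → e ∉ M := fun {e} h1 h2 =>
    hp.ne_top ((Ideal.eq_top_iff_one M).2 (by simpa using M.add_mem h1 h2))
  have hor : ∀ {e : S}, IsIdempotentElem e → e ∉ M → 1 - e ∈ M := fun {e} he h =>
    (hp.mem_or_mem (show e * (1 - e) ∈ M by
      rw [mul_sub, he.eq, mul_one, sub_self]; exact M.zero_mem)).resolve_left h
  obtain ⟨x, hx⟩ := exists_point_of_filter D {e | IsIdempotentElem e ∧ e ∉ M}
    (fun e he => he.1) (fun h => h.2 M.zero_mem)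
    (fun e he f hf => ⟨he.1.mul hf.1, fun h => (hp.mem_or_mem h).elim he.2 hf.2⟩)
    ⟨d, hd, hsub hdM'⟩
    (fun e he f hf hef => ⟨hf, fun h => he.2 (hef ▸ M.mul_mem_left e h)⟩)
    (fun e f he hf hef => by
      by_cases h : f ∈ M
      · refine Or.inr ⟨he.one_sub, hsub ?_⟩
        rw [sub_sub_cancel, ← D.le e f he hf hef]
        exact M.mul_mem_left e h
      · exact Or.inl ⟨hf, h⟩)
  exact ⟨x, (hx e).2 ⟨he, d, ⟨hd, hsub hdM'⟩, hde⟩⟩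

theorem mul_eq_zero_of_disjoint {e f : S} (he : IsIdempotentElem e) (hf : IsIdempotentElem f)
    (h : Disjoint (basic prec e) (basic prec f)) : e * f = 0 := by
  by_contra h0
  obtain ⟨x, hx⟩ := basic_nonempty D (he.mul hf) h0
  rw [basic_mul he hf] at hx
  exact Set.disjoint_left.1 h hx.1 hx.2

theorem mul_eq_of_subset_closure {e f : S} (he : IsIdempotentElem e) (hf : IsIdempotentElem f)
    (h : basic prec e ⊆ closure (basic prec f)) : e * f = e := by
  have h1 := (disjoint_basic_compl hf).closure_left (isOpen_basic (prec := prec) hf.one_sub)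
  have h2 := mul_eq_zero_of_disjoint D he hf.one_sub (h1.mono_left h)
  rw [mul_sub, mul_one, sub_eq_zero] at h2
  exact h2.symm

/-- Forward, roundness covers the closure by basic sets of idempotents `g ≺ f`, and compactness
leaves finitely many, whose join is still `≺ f`. Backward, a point in the closure cannot contain `1
- e`, so primality gives `f`. -/
theorem closure_basic_subset_iff {e f : S} (he : IsIdempotentElem e) (hf : IsIdempotentElem f) :
    closure (basic prec e) ⊆ basic prec f ↔ prec e f := by
  constructor
  · intro h
    have := compactSpace D
    obtain ⟨g, hg, hgf, hsub⟩ :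
        ∃ g, IsIdempotentElem g ∧ prec g f ∧ closure (basic prec e) ⊆ basic prec g := by
      refine (isClosed_closure (s := basic prec e)).isCompact.induction_on ?_ ?_ ?_ ?_
      · exact ⟨0, IsIdempotentElem.zero,
          D.mono_right 0 0 f IsIdempotentElem.zero hf (zero_mul f) D.zero_zero,
          Set.empty_subset _⟩
      · rintro s t hst ⟨g, hg, hgf, hsub⟩
        exact ⟨g, hg, hgf, hst.trans hsub⟩
      · rintro s t ⟨g, hg, hgf, hs⟩ ⟨k, hk, hkf, ht⟩
        -- The join of `g` and `k` is `1 - (1 - g) * (1 - k)`, so closure under joins follows from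
        -- products and complements.
        have h1 := D.compl _ _ (D.mul _ _ _ _ hf.one_sub hg.one_sub hf.one_sub hk.one_sub
          (D.compl _ _ hgf) (D.compl _ _ hkf))
        rw [hf.one_sub.eq, sub_sub_cancel] at h1
        have hgk := (hg.one_sub.mul hk.one_sub).one_sub
        refine ⟨_, hgk, h1, Set.union_subset (hs.trans (basic_mono hgk ?_))
          (ht.trans (basic_mono hgk ?_))⟩
        · linear_combination (1 - k) * hg.eq
        · linear_combination (1 - g) * hk.eq
      · intro x hx
        obtain ⟨g, hgx, hgf⟩ := x.round f (h hx)
        exact ⟨basic prec g, mem_nhdsWithin_of_mem_nhds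
          ((isOpen_basic (x.idem g hgx)).mem_nhds hgx), g, x.idem g hgx, hgf, subset_rfl⟩
    exact D.mono_left e g f he hg (mul_eq_of_subset_closure D he hg
      ((subset_closure.trans hsub).trans subset_closure)) hgf
  · intro hef x hx
    refine (x.prime e f he hf hef).resolve_right fun h => ?_
    exact Set.disjoint_left.1
      ((disjoint_basic_compl he).closure_left (isOpen_basic he.one_sub)) hx h

/-- The idempotent sought is the join of all `f` with `basic prec f ⊆ V`. It is `1 - d`, where `d`
generates their annihilator. -/
theorem exists_basic_eq (hB : IsBaerRing S) {V : Set (DeVriesPoint S prec)} (hVo : IsOpen V)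
    (hV : interior (closure V) = V) : ∃ e, IsIdempotentElem e ∧ basic prec e = V := by
  obtain ⟨d, hd, hann⟩ := hB.annihilator {f | IsIdempotentElem f ∧ basic prec f ⊆ V}
  have hmem : ∀ s, (∀ f, IsIdempotentElem f ∧ basic prec f ⊆ V → s * f = 0) ↔
      ∃ r, r * d = s := fun s => by
    rw [← Ideal.mem_span_singleton', ← SetLike.mem_coe, ← hann]
    rfl
  refine ⟨1 - d, hd.one_sub, subset_antisymm ?_ fun x hx => ?_⟩
  · rw [← hV]
    refine interior_maximal (fun x hx => ?_) (isOpen_basic hd.one_sub)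
    refine mem_closure_iff.2 fun o ho hxo => ?_
    by_contra hemp
    obtain ⟨k, hk, hxk, hko⟩ := exists_basic_subset D ho hxo
    -- A basic set disjoint from `V` belongs to an idempotent `k` annihilating all these `f`. So `k`
    -- is a multiple of `d`, and its basic set misses that of `1 - d`.
    obtain ⟨r, hr⟩ := (hmem k).1 fun f hf => mul_eq_zero_of_disjoint D hk hf.1
      (Set.disjoint_left.2 fun y hy hy' => hemp ⟨y, hko hy, hf.2 hy'⟩)
    have hx' : x ∈ basic prec (k * (1 - d)) := by
      rw [basic_mul hk hd.one_sub]; exact ⟨hxk, hx⟩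
    rw [← hr, mul_assoc, mul_sub, hd.eq, mul_one, sub_self, mul_zero, basic_zero] at hx'
    exact hx'
  · obtain ⟨f, hf, hxf, hfV⟩ := exists_basic_subset D hVo hx
    have h1 := (hmem d).2 ⟨1, one_mul d⟩ f ⟨hf, hfV⟩
    exact basic_mono hd.one_sub (by rw [mul_sub, mul_one, mul_comm f, h1, sub_zero]) hxf

/-- A point may contain neither `e` nor `1 - e`, so a partition of unity need not cover the dual.
This is why elements are represented only after normalization. -/
theorem dense_iUnion_basic {ι : Type*} [Fintype ι] {e : ι → S}
    (he : ∀ i, IsIdempotentElem (e i)) (h1 : ∑ i, e i = 1) :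
    Dense (⋃ i, basic prec (e i)) := by
  refine dense_iff_inter_open.2 fun U hU ⟨x, hx⟩ => ?_
  obtain ⟨f, hf, hxf, hfU⟩ := exists_basic_subset D hU hx
  obtain ⟨i, hi⟩ : ∃ i, f * e i ≠ 0 := by
    by_contra! hc
    refine x.zero_notMem ?_
    rwa [mem_basic, ← mul_one f, ← h1, Finset.mul_sum, Finset.sum_eq_zero fun i _ => hc i] at hxf
  obtain ⟨y, hy⟩ := basic_nonempty D (hf.mul (he i)) hi
  rw [basic_mul hf (he i)] at hy
  exact ⟨y, hfU hy.1, Set.mem_iUnion.2 ⟨i, hy.2⟩⟩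

end DeVriesPoint
/-! ## Representation of proximity Baer Specker algebras -/

section Representation

variable {A : Type v} [CommRing A] {S : Type u} [CommRing S]
  [Algebra A S] {prec : S → S → Prop}

open DeVriesPoint FN

/-- The element `s` has the value `a` near the point `x`. -/
def DeVriesPoint.HasValue (x : DeVriesPoint S prec) (s : S) (a : A) : Prop :=
  ∃ e ∈ x.carrier, s * e = a • e

theorem DeVriesPoint.HasValue.map₂ {x : DeVriesPoint S prec} {s t : S} {a b : A}
    (hs : x.HasValue s a) (ht : x.HasValue t b) (r : S) (c : A)
    (h : ∀ e : S, s * e = a • e → t * e = b • e → r * e = c • e) : x.HasValue r c := by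
  obtain ⟨e, he, hse⟩ := hs
  obtain ⟨f, hf, htf⟩ := ht
  refine ⟨e * f, x.mul_mem e he f hf, h _ ?_ ?_⟩
  · rw [← mul_assoc, hse, smul_mul_assoc]
  · rw [mul_left_comm, htf, mul_smul_comm]

theorem DeVriesPoint.HasValue.add {x : DeVriesPoint S prec} {s t : S} {a b : A}
    (hs : x.HasValue s a) (ht : x.HasValue t b) : x.HasValue (s + t) (a + b) :=
  hs.map₂ ht _ _ fun e h h' => by rw [add_mul, h, h', add_smul]

theorem DeVriesPoint.HasValue.mul {x : DeVriesPoint S prec} {s t : S} {a b : A}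
    (hs : x.HasValue s a) (ht : x.HasValue t b) : x.HasValue (s * t) (a * b) :=
  hs.map₂ ht _ _ fun e h h' => by rw [mul_assoc, h', mul_smul_comm, h, smul_smul, mul_comm]

theorem StepPartition.eventually_mem (D : IsDeVriesProximity S prec) {s : S}
    {ι : Type} [Fintype ι] (P : StepPartition A s ι) :
    ∀ᶠ x in denseFilter (DeVriesPoint S prec), ∃ i, P.idem i ∈ x.carrier := by
  have h := eventually_denseFilter_of_isOpen
    (isOpen_iUnion fun i => isOpen_basic (prec := prec) (P.isIdempotentElem i))
    (dense_iUnion_basic D P.isIdempotentElem P.sum_idem)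
  filter_upwards [h] with x hx
  exact Set.mem_iUnion.1 hx

variable [LinearOrder A] [Lattice S]

theorem DeVriesPoint.HasValue.unique (h : IsProximityFAlgebra A S prec)
    {x : DeVriesPoint S prec} {s : S} {a b : A}
    (ha : x.HasValue s a) (hb : x.HasValue s b) : a = b := by
  obtain ⟨e, he, hse⟩ := ha
  obtain ⟨f, hf, hsf⟩ := hb
  have h1 : (a - b) • (e * f) = 0 := by
    rw [sub_smul, ← smul_mul_assoc, ← hse, ← mul_smul_comm, ← hsf]
    ring
  refine sub_eq_zero.1 ((h.torsionFree _ _ h1).resolve_right fun h0 => ?_)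
  exact x.zero_notMem (h0 ▸ x.mul_mem e he f hf)

variable [IsStrictOrderedRing A]

theorem DeVriesPoint.HasValue.nonneg (h : IsProximityFAlgebra A S prec)
    {x : DeVriesPoint S prec} {s : S} {a : A} (ha : x.HasValue s a) (hs : 0 ≤ s) : 0 ≤ a := by
  have := h.isFRing.isOrderedRing
  obtain ⟨e, he, hse⟩ := ha
  have he0 := h.isFRing.idempotent_nonneg (x.idem e he)
  exact h.nonneg_of_smul_nonneg he0 (fun h0 => x.zero_notMem (h0 ▸ he))
    (hse ▸ mul_nonneg hs he0)

theorem IsProximityFAlgebra.exists_FN (h : IsProximityFAlgebra A S prec) (hS : IsSpecker A S)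
    (s : S) : ∃ f : FN (DeVriesPoint S prec) A,
      ∀ᶠ x in denseFilter (DeVriesPoint S prec), x.HasValue s (f x) := by
  classical
  obtain ⟨ι, _, ⟨P⟩⟩ := hS.exists_stepPartition s
  have hP := P.eventually_mem (h.isDeVriesProximity hS)
  -- The default `0` is used only at points containing no block; the remaining points contain a
  -- dense open set, so it does not affect the conclusion.
  set v : DeVriesPoint S prec → A := fun x =>
    if hx : ∃ i, P.idem i ∈ x.carrier then P.val hx.choose else 0 with hv
  have hval : ∀ x : DeVriesPoint S prec, (∃ i, P.idem i ∈ x.carrier) → x.HasValue s (v x) := by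
    intro x hx
    simp only [hv, dif_pos hx]
    exact ⟨_, hx.choose_spec, P.mul_idem _⟩
  have hfin : (Set.range v).Finite := by
    refine ((Set.finite_range P.val).insert 0).subset ?_
    rintro _ ⟨x, rfl⟩
    by_cases hx : ∃ i, P.idem i ∈ x.carrier
    · exact Or.inr ⟨hx.choose, by simp only [hv, dif_pos hx]⟩
    · exact Or.inl (by simp only [hv, dif_neg hx])
  have htame : Tame v := by
    filter_upwards [hP] with x ⟨i, hi⟩
    have key : ∀ y ∈ basic prec (P.idem i), v y = P.val i := fun y hy =>
      (hval y ⟨i, hy⟩).unique h ⟨_, hy, P.mul_idem i⟩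
    filter_upwards [(isOpen_basic (P.isIdempotentElem i)).mem_nhds hi] with y hy
    rw [key y hy, key x hi]
  refine ⟨normalize v hfin, ?_⟩
  filter_upwards [normalize_eventuallyEq v hfin htame, hP] with x h1 h2
  rw [h1]
  exact hval x h2

/-- The representation of a proximity Specker algebra by normal functions on its dual. -/
noncomputable def toFN (h : IsProximityFAlgebra A S prec) (hS : IsSpecker A S) :
    S →ₐ[A] FN (DeVriesPoint S prec) A :=
  have hspec := fun s => (h.exists_FN hS s).choose_spec
  -- The normal function representing `s` is unique, so each homomorphism law reduces to the
  -- corresponding law for values.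
  have heq : ∀ (s : S) (f : FN (DeVriesPoint S prec) A),
      (∀ᶠ x in denseFilter (DeVriesPoint S prec), x.HasValue s (f x)) →
      (h.exists_FN hS s).choose = f := fun s f hf => ext_of_eventuallyEq (by
    filter_upwards [hf, hspec s] with x h1 h2 using h2.unique h h1)
  have hscalar : ∀ a : A, (h.exists_FN hS (algebraMap A S a)).choose =
      algebraMap A (FN (DeVriesPoint S prec) A) a := fun a => heq _ _ (Filter.Eventually.of_forall
    fun x => ⟨1, one_mem (h.isDeVriesProximity hS) x, (Algebra.smul_def a (1 : S)).symm⟩)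
  { toFun s := (h.exists_FN hS s).choose
    map_one' := by simpa using hscalar 1
    map_zero' := by simpa using hscalar 0
    map_mul' s t := heq _ _ (by
      filter_upwards [hspec s, hspec t, mul_ae (h.exists_FN hS s).choose (h.exists_FN hS t).choose]
        with x h1 h2 h3
      rw [h3]
      exact h1.mul h2)
    map_add' s t := heq _ _ (by
      filter_upwards [hspec s, hspec t, add_ae (h.exists_FN hS s).choose (h.exists_FN hS t).choose]
        with x h1 h2 h3
      rw [h3]
      exact h1.add h2)
    commutes' := hscalar }

variable (h : IsProximityFAlgebra A S prec) (hS : IsSpecker A S)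

theorem hasValue_toFN (s : S) :
    ∀ᶠ x in denseFilter (DeVriesPoint S prec), x.HasValue s (toFN h hS s x) :=
  (h.exists_FN hS s).choose_spec

theorem toFN_idempotent {e : S} (he : IsIdempotentElem e) :
    ∀ᶠ x in denseFilter (DeVriesPoint S prec),
      (x ∈ basic prec e ∧ toFN h hS e x = 1) ∨ (x ∉ basic prec e ∧ toFN h hS e x = 0) := by
  have D := h.isDeVriesProximity hS
  filter_upwards [hasValue_toFN h hS e,
    (StepPartition.ofIdempotent (A := A) he).eventually_mem D] with x h1 ⟨b, hb⟩
  have h2 := h1.unique h ⟨_, hb, (StepPartition.ofIdempotent he).mul_idem b⟩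
  cases b
  · exact Or.inr ⟨fun hx => Set.disjoint_left.1 (disjoint_basic_compl he) hx hb, h2⟩
  · exact Or.inl ⟨hb, h2⟩

/-- Every nonzero block has a nonempty basic set, hence a point where `toFN` takes the scalar of
that block. Nonnegativity can thus be read back block by block. -/
theorem toFN_nonneg_iff (s : S) : 0 ≤ toFN h hS s ↔ 0 ≤ s := by
  have D := h.isDeVriesProximity hS
  have := h.isFRing.isOrderedRing
  constructor
  · intro h0
    obtain ⟨ι, _, ⟨P⟩⟩ := hS.exists_stepPartition s
    refine P.le_of_mul_le fun i => ?_
    by_cases hi : P.idem i = 0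
    · rw [hi, mul_zero, mul_zero]
    · obtain ⟨x, hx, hv⟩ := exists_of_eventually (hasValue_toFN h hS s)
        (isOpen_basic (P.isIdempotentElem i)) (basic_nonempty D (P.isIdempotentElem i) hi)
      have : toFN h hS s x = P.val i := hv.unique h ⟨_, hx, P.mul_idem i⟩
      rw [zero_mul, P.mul_idem]
      exact h.smul_nonneg _ _ (this ▸ h0 x) (h.isFRing.idempotent_nonneg (P.isIdempotentElem i))
  · intro hs
    refine le_of_eventually_le ?_
    filter_upwards [hasValue_toFN h hS s] with x hx
    exact hx.nonneg h hs

theorem toFN_le_iff (s t : S) : toFN h hS s ≤ toFN h hS t ↔ s ≤ t := by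
  have := h.isFRing.isOrderedRing
  rw [← sub_nonneg (a := t), ← toFN_nonneg_iff h hS, map_sub]
  constructor
  · intro hst
    refine le_of_eventually_le ?_
    filter_upwards [sub_ae (toFN h hS t) (toFN h hS s)] with x hx
    rw [hx]
    exact sub_nonneg.2 (hst x)
  · intro h0
    refine le_of_eventually_le ?_
    filter_upwards [sub_ae (toFN h hS t) (toFN h hS s)] with x hx
    exact sub_nonneg.1 (hx ▸ h0 x)

theorem toFN_injective : Function.Injective (toFN h hS) := fun s t hst =>
  le_antisymm ((toFN_le_iff h hS s t).1 hst.le) ((toFN_le_iff h hS t s).1 hst.ge)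

/-- Idempotents generate the target, so it suffices to hit them. An idempotent `f` comes from the
`e` whose basic set is the regular open set `[1 ≤ f]`. -/
theorem toFN_surjective (hB : IsBaerRing S) : Function.Surjective (toFN h hS) := by
  have D := h.isDeVriesProximity hS
  rw [← AlgHom.range_eq_top, eq_top_iff, ← adjoin_idempotents]
  refine Algebra.adjoin_le fun f hf => ?_
  have hf' : f * f = f := hf
  obtain ⟨e, he, heq⟩ := exists_basic_eq D hB (f.isOpen_preimage 1) (f.normal 1)
  refine ⟨e, ext_of_eventuallyEq ?_⟩
  filter_upwards [toFN_idempotent h hS he, mul_ae f f] with x h1 h2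
  rw [hf'] at h2
  have h3 : f x = 0 ∨ f x = 1 := by
    by_cases h0 : f x = 0
    · exact Or.inl h0
    · exact Or.inr (mul_left_cancel₀ h0 (by rw [mul_one]; exact h2.symm))
  rw [heq] at h1
  change toFN h hS e x = f x
  rcases h1 with ⟨hx, h1⟩ | ⟨hx, h1⟩ <;> rw [h1] <;> rcases h3 with h3 | h3
  · have : (1 : A) ≤ f x := hx
    exact absurd (h3 ▸ this) (not_le.2 one_pos)
  · exact h3.symm
  · exact h3.symm
  · exact absurd (show (1 : A) ≤ f x from h3.ge) hx

/-- The representation of a proximity Baer Specker algebra as a de Vries power. -/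
noncomputable def equivFN (hB : IsBaerRing S) : S ≃ₐ[A] FN (DeVriesPoint S prec) A :=
  AlgEquiv.ofBijective (toFN h hS) ⟨toFN_injective h hS, toFN_surjective h hS hB⟩

theorem toFN_sup (hB : IsBaerRing S) (s t : S) :
    toFN h hS (s ⊔ t) = toFN h hS s ⊔ toFN h hS t :=
  OrderIso.map_sup (⟨(equivFN h hS hB).toEquiv, toFN_le_iff h hS _ _⟩ : S ≃o FN _ A) s t

theorem toFN_inf (hB : IsBaerRing S) (s t : S) :
    toFN h hS (s ⊓ t) = toFN h hS s ⊓ toFN h hS t :=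
  OrderIso.map_inf (⟨(equivFN h hS hB).toEquiv, toFN_le_iff h hS _ _⟩ : S ≃o FN _ A) s t

theorem toFN_algebraMap (a : A) :
    toFN h hS (algebraMap A S a) = const (DeVriesPoint S prec) a :=
  (toFN h hS).commutes a

/-- This splits off one layer: raising the truncation height from `b` to the next value `a` adds `a
- b` exactly where `s` is at least `a`. -/
theorem inf_eq_inf_add_smul (hB : IsBaerRing S) {s e : S} (he : IsIdempotentElem e) {a b : A}
    (hab : b ≤ a) (hs : ∀ x, a ≤ toFN h hS s x ∨ toFN h hS s x ≤ b)
    (hes : basic prec e = toFN h hS s ⁻¹' Set.Ici a) :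
    s ⊓ algebraMap A S a = s ⊓ algebraMap A S b + (a - b) • e := by
  refine toFN_injective h hS (ext_of_eventuallyEq ?_)
  rw [map_add, map_smul, toFN_inf h hS hB, toFN_inf h hS hB, toFN_algebraMap, toFN_algebraMap]
  filter_upwards [toFN_idempotent h hS he, smul_ae (a - b) (toFN h hS e),
    add_ae (toFN h hS s ⊓ const _ b) ((a - b) • toFN h hS e)] with x h1 h2 h3
  rw [h3, h2, inf_apply, inf_apply, const_apply, const_apply]
  rw [hes] at h1
  rcases h1 with ⟨hx, h1⟩ | ⟨hx, h1⟩ <;> rw [h1]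
  · have hx' : a ≤ toFN h hS s x := hx
    rw [min_eq_right hx', min_eq_right (hab.trans hx'), mul_one, add_sub_cancel]
  · have hx' := (hs x).resolve_left hx
    rw [min_eq_left hx', min_eq_left (hx'.trans hab), mul_zero, add_zero]

theorem level_of_toFN (hB : IsBaerRing S) {s e : S} (he : IsIdempotentElem e) {a b : A}
    (hab : b ≤ a) (hs : ∀ x, a ≤ toFN h hS s x ∨ toFN h hS s x ≤ b)
    (hes : basic prec e = toFN h hS s ⁻¹' Set.Ici a) :
    (s ⊓ algebraMap A S a) ⊔ algebraMap A S b = algebraMap A S b + (a - b) • e := by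
  refine toFN_injective h hS (ext_of_eventuallyEq ?_)
  rw [map_add, map_smul, toFN_sup h hS hB, toFN_inf h hS hB, toFN_algebraMap, toFN_algebraMap]
  filter_upwards [toFN_idempotent h hS he, smul_ae (a - b) (toFN h hS e),
    add_ae (const _ b) ((a - b) • toFN h hS e),
    sup_ae (toFN h hS s ⊓ const _ a) (const _ b)] with x h1 h2 h3 h4
  rw [h3, h4, h2, inf_apply, const_apply, const_apply]
  rw [hes] at h1
  rcases h1 with ⟨hx, h1⟩ | ⟨hx, h1⟩ <;> rw [h1]
  · have hx' : a ≤ toFN h hS s x := hx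
    rw [min_eq_right hx', max_eq_left hab, mul_one, add_sub_cancel]
  · have hx' := (hs x).resolve_left hx
    rw [min_eq_left (hx'.trans hab), max_eq_right hx', mul_zero, add_zero]

theorem exists_gap {A : Type*} [LinearOrder A] (F : Finset A) (a : A) :
    (∀ c ∈ F, a ≤ c) ∨ ∃ b ∈ F, b < a ∧ ∀ c ∈ F, a ≤ c ∨ c ≤ b := by
  by_cases hF : (F.filter (· < a)).Nonempty
  · have hb := Finset.mem_filter.1 (Finset.max'_mem _ hF)
    refine Or.inr ⟨_, hb.1, hb.2, fun c hc => (le_or_gt a c).imp_right fun hca => ?_⟩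
    exact Finset.le_max' _ _ (Finset.mem_filter.2 ⟨hc, hca⟩)
  · refine Or.inl fun c hc => not_lt.1 fun hca => hF ⟨c, Finset.mem_filter.2 ⟨hc, hca⟩⟩

/-- One direction cuts `s` and `t` at adjacent values to compare level idempotents; the other
rebuilds them as sums of layers using (P6) and (P7). -/
theorem prec_iff_toFN_prec (hB : IsBaerRing S) (s t : S) :
    prec s t ↔ FN.Prec (toFN h hS s) (toFN h hS t) := by
  have D := h.isDeVriesProximity hS
  have := h.isFRing.isOrderedRing
  set F : Finset A := ((toFN h hS s).finite.union (toFN h hS t).finite).toFinset with hF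
  have hsF : ∀ x, toFN h hS s x ∈ F := fun x => by simp [hF]
  have htF : ∀ x, toFN h hS t x ∈ F := fun x => by simp [hF]
  constructor
  · intro hst a
    rcases exists_gap F a with ha | ⟨b, -, hba, hb⟩
    · exact fun x _ => ha _ (htF x)
    · obtain ⟨e, he, hes⟩ :=
        exists_basic_eq D hB ((toFN h hS s).isOpen_preimage a) ((toFN h hS s).normal a)
      obtain ⟨f, hf, hft⟩ :=
        exists_basic_eq D hB ((toFN h hS t).isOpen_preimage a) ((toFN h hS t).normal a)
      rw [← hes, ← hft, closure_basic_subset_iff D he hf]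
      exact h.isProximity.of_level hba hst
        (level_of_toFN h hS hB he hba.le (fun x => hb _ (hsF x)) hes)
        (level_of_toFN h hS hB hf hba.le (fun x => hb _ (htF x)) hft)
  · intro hst
    -- Induction up the finite set of values adds one layer at a time; truncating at the maximum of
    -- `F` recovers `s` and `t`.
    have key : ∀ c ∈ F, prec (s ⊓ algebraMap A S c) (t ⊓ algebraMap A S c) := by
      intro c hc
      refine Set.WellFoundedOn.induction
        (P := fun c => prec (s ⊓ algebraMap A S c) (t ⊓ algebraMap A S c))
        F.finite_toSet.isWF hc fun a _ ih => ?_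
      rcases exists_gap F a with ha | ⟨b, hbF, hba, hb⟩
      · have hle : ∀ r : S, (∀ x, toFN h hS r x ∈ F) → r ⊓ algebraMap A S a = algebraMap A S a :=
          fun r hr => inf_eq_right.2 ((toFN_le_iff h hS _ _).1 (by
            rw [toFN_algebraMap]
            exact fun x => ha _ (hr x)))
        rw [hle s hsF, hle t htF]
        exact h.isProximity.algebraMap_self a
      · obtain ⟨e, he, hes⟩ :=
          exists_basic_eq D hB ((toFN h hS s).isOpen_preimage a) ((toFN h hS s).normal a)
        obtain ⟨f, hf, hft⟩ :=
          exists_basic_eq D hB ((toFN h hS t).isOpen_preimage a) ((toFN h hS t).normal a)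
        have hef := hst a
        rw [← hes, ← hft, closure_basic_subset_iff D he hf] at hef
        rw [inf_eq_inf_add_smul h hS hB he hba.le (fun x => hb _ (hsF x)) hes,
          inf_eq_inf_add_smul h hS hB hf hba.le (fun x => hb _ (htF x)) hft]
        exact h.isProximity.add _ _ _ _ (ih b hbF hba)
          (h.isProximity.smul _ _ hef _ (sub_pos.2 hba))
    -- If `F` is empty, the dual has no points and `S` is the zero algebra.
    rcases F.eq_empty_or_nonempty with hemp | hne
    · have h0 : ∀ r : S, r = 0 := fun r => toFN_injective h hS (coe_injective fun x =>
        absurd (hsF x) (by simp [hemp]))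
      rw [h0 s, h0 t]
      exact h.isProximity.zero_zero
    · have hle : ∀ r : S, (∀ x, toFN h hS r x ∈ F) → r ⊓ algebraMap A S (F.max' hne) = r :=
        fun r hr => inf_eq_left.2 ((toFN_le_iff h hS _ _).1 (by
          rw [toFN_algebraMap]
          exact fun x => F.le_max' _ (hr x)))
      have := key _ (F.max'_mem hne)
      rwa [hle s hsF, hle t htF] at this

theorem exists_algEquiv_FN (h : IsProximityFAlgebra A S prec) (hS : IsSpecker A S)
    (hB : IsBaerRing S) :
    ∃ (X : Type u) (_ : TopologicalSpace X) (_ : CompactSpace X) (_ : T2Space X)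
        (η : S ≃ₐ[A] FN X A),
      (∀ s t, η (s ⊔ t) = η s ⊔ η t) ∧ (∀ s t, η (s ⊓ t) = η s ⊓ η t) ∧
      (∀ s t, prec s t ↔ FN.Prec (η s) (η t)) := by
  have D := h.isDeVriesProximity hS
  exact ⟨DeVriesPoint S prec, inferInstance, compactSpace D, t2Space, equivFN h hS hB,
    toFN_sup h hS hB, toFN_inf h hS hB, prec_iff_toFN_prec h hS hB⟩

end Representation

theorem mainTheorem3 {A : Type v} [CommRing A] [LinearOrder A] [IsStrictOrderedRing A]
    {S : Type u} [Ring S] [Algebra A S] [Lattice S] (prec : S → S → Prop)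
    (hS : IsProximityFAlgebra A S prec) :
    (∃ (X : Type u) (_ : TopologicalSpace X) (_ : CompactSpace X) (_ : T2Space X)
        (η : S ≃ₐ[A] FN X A),
      (∀ s t, η (s ⊔ t) = η s ⊔ η t) ∧ (∀ s t, η (s ⊓ t) = η s ⊓ η t) ∧
      (∀ s t, prec s t ↔ FN.Prec (η s) (η t))) ↔
    IsProximityBaerSpecker A S prec := by
  constructor
  · rintro ⟨X, _, _, _, η, -, -, -⟩
    exact ⟨hS, isSpecker_of_algEquiv_FN η hS.torsionFree, isBaerRing_of_algEquiv_FN η⟩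
  · intro h
    -- `S` is only assumed to be a ring; commutativity is part of the Specker condition.
    let _ : CommRing S := { ‹Ring S› with mul_comm := h.isSpecker.mul_comm }
    exact exists_algEquiv_FN h.toIsProximityFAlgebra h.isSpecker h.isBaer
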